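/- **Setting.** Let $\Omega\subseteq\mathbb R^d$ and $\epsilon>0$. $\mathcal P_2(\Omega)$ is the set of probability measures with support in $\Omega$ and finite second moment. For $\sigma>0$, $\mathcal G_\sigma(\Omega)$ is the set of probability measures $\mu$ with support in $\Omega$ such that $\sup_{\|v\|=1}\mathbb E_{X\sim\mu}\exp(\langle X,v\rangle^2/\sigma^2)\le 2$. Let $(f,g)$ be entropic potentials from $\mu$ to $\nu$, i.e. a maximizer over $L^1(\mu)\times L^1(\nu)$ of $$\int f\,d\mu+\int g\,d\nu-\epsilon\int\Big(e^{-\frac1\epsilon(\frac12\|x-y\|^2-f(x)-g(y))}-1\Big)d\mu(x)d\nu(y),$$ with $f(x)=-\epsilon\log\int e^{-\frac1\epsilon(\frac12\|x-y\|^2-g(y))}d\nu(y)$ for all $x$ and $g(y)=-\epsilon\log\int e^{-\frac1\epsilon(\frac12\|x-y\|^2-f(x))}d\mu(x)$ for $\nu$-a.e. $y$. The entropic map is $$T^\epsilon_{\mu\to\nu}(x)=\frac{\int y\,e^{\frac1\epsilon(-\frac12\|x-y\|^2+g(y))}d\nu(y)}{\int e^{\frac1\epsilon(-\frac12\|x-y\|^2+g(y))}d\nu(y)}.$$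 For $\nu_1,\dots,\nu_m\in\mathcal G_\sigma(\Omega)$ let $$[A^\epsilon_\mu]_{ij}=\int\langle T^\epsilon_{\mu\to\nu_i}(x)-x,\,T^\epsilon_{\mu\to\nu_j}(x)-x\rangle d\mu(x),\qquad [S^\epsilon_\mu]_{ij}=\int\langle T^\epsilon_{\mu\to\nu_i}(x)-T^\epsilon_{\mu\to\mu}(x),\,T^\epsilon_{\mu\to\nu_j}(x)-T^\epsilon_{\mu\to\mu}(x)\rangle d\mu(x),$$ and let $\Delta^m$ be the probability simplex in $\mathbb R^m$. **Algorithm.** Draw mutually independent samples $X_1,\dots,X_{2n}\sim\mu$ and $Y^j_1,\dots,Y^j_n\sim\nu_j$ ($1\le j\le m$). For each $j$ let $\hat T_j$ be an estimator of $T^\epsilon_{\mu\to\nu_j}$ that is a measurable function of $X_1,\dots,X_n,Y^j_1,\dots,Y^j_n$; in the Sinkhorn case let $\hat T$ be an estimator of $T^\epsilon_{\mu\to\mu}$ that is a measurable function of $X_1,\dots,X_n$. Put $R(x)=x$ in the entropic case and $R=\hat T$ in the Sinkhorn case, let $$\hat M_{ij}=\frac1n\sum_{k=n+1}^{2n}\langle\hat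 T_i(X_k)-R(X_k),\,\hat T_j(X_k)-R(X_k)\rangle ,$$ and output a (measurably chosen) $\hat\lambda^n\in\arg\min_{\lambda\in\Delta^m}\lambda^\top\hat M\lambda$. **Theorem.** There are absolute constants $J,\tilde J>0$ such that the following holds for every nonincreasing $\theta:\mathbb N\to\mathbb R_{\ge0}$. 1. (Entropic case.) Let $\mu\in\mathcal P_2(\Omega)$ and suppose that $A^\epsilon_\mu$ has the eigenvalue $0$ with multiplicity one, with eigenvector $\lambda_*\in\Delta^m$, and smallest nonzero eigenvalue $\alpha_2$. If $\mathbb E\|T^\epsilon_{\mu\to\nu_j}-\hat T_j\|^2_{L^2(\mu)}\le\theta(n)$ for all $j$ and all $n\ge1$, then for all $n\ge 1$ $$\mathbb E\|\hat\lambda^n-\lambda_*\|_2^2\le\frac{J\,m^3\max\{1,d\sigma^2\}}{\alpha_2}\max\Big\{\frac1{\sqrt n},\sqrt{\theta(n)+\theta(n)^2}\Big\}.$$ 2. (Sinkhorn case.) Let $\mu\in\mathcal G_\sigma(\Omega)$ and suppose that $S^\epsilon_\mu$ has the eigenvalue $0$ with multiplicity one, with eigenvector $\lambda_*\in\Delta^m$,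 and smallest nonzero eigenvalue $\alpha_2$. If, for all $n\ge1$, $\mathbb E\|T^\epsilon_{\mu\to\nu_j}-\hat T_j\|^2_{L^2(\mu)}\le\theta(n)$ for all $j$ and $\mathbb E\|T^\epsilon_{\mu\to\mu}-\hat T\|^2_{L^2(\mu)}\le\theta(n)$, then for all $n\ge 1$ $$\mathbb E\|\hat\lambda^n-\lambda_*\|_2^2\le\frac{\tilde J\,m^3\max\{1,d\sigma^2\}}{\alpha_2}\max\Big\{\frac1{\sqrt n},\sqrt{\theta(n)+\theta(n)^2}\Big\}.$$ -/

import Mathlib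

open MeasureTheory ProbabilityTheory
open scoped ENNReal

/-- `ℝ^d` with the Euclidean norm and inner product. -/
abbrev Euc (d : ℕ) : Type := EuclideanSpace ℝ (Fin d)

/-- `μ ∈ 𝒫₂(Ω)`: a probability measure on `ℝ^d` with support contained in `Ω` and finite second
moment. -/
structure IsP2 {d : ℕ} (Ω : Set (Euc d)) (μ : Measure (Euc d)) : Prop where
  isProb : IsProbabilityMeasure μ
  support_subset : μ.support ⊆ Ω
  second_moment : MemLp id 2 μ

/-- `μ ∈ 𝒢_σ(Ω)`: a probability measure on `ℝ^d` with support contained in `Ω` and subgaussian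
constant at most `σ`, i.e. `sup_{‖v‖ = 1} E exp(⟨X, v⟩² / σ²) ≤ 2` for `X ∼ μ`.  The condition is
monotone in `σ > 0`, and the subgaussian norm is the least `σ` for which it holds.  Positivity of
`σ` is part of the definition, so that the quotient is never a division by zero. -/
structure IsSubgaussian {d : ℕ} (Ω : Set (Euc d)) (σ : ℝ) (μ : Measure (Euc d)) : Prop where
  isProb : IsProbabilityMeasure μ
  support_subset : μ.support ⊆ Ω
  sigma_pos : 0 < σ
  exp_moment : ∀ v : Euc d, ‖v‖ = 1 →
    ∫⁻ x, ENNReal.ofReal (Real.exp ((inner ℝ x v) ^ 2 / σ ^ 2)) ∂μ ≤ 2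

/-- The integrand `exp(-(½‖x - y‖² - f(x) - g(y)) / ε)` of the dual entropic transport problem. -/
noncomputable def gibbs {d : ℕ} (ε : ℝ) (f g : Euc d → ℝ) (p : Euc d × Euc d) : ℝ :=
  Real.exp (-(1 / ε) * (1 / 2 * ‖p.1 - p.2‖ ^ 2 - f p.1 - g p.2))

/-- The dual objective of the entropy-regularized transport problem,
`∫ f dμ + ∫ g dν - ε ∫ (exp(-(½‖x - y‖² - f(x) - g(y)) / ε) - 1) d(μ ⊗ ν)`. -/
noncomputable def dualObjective {d : ℕ} (ε : ℝ) (μ ν : Measure (Euc d)) (f g : Euc d → ℝ) : ℝ :=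
  ∫ x, f x ∂μ + ∫ y, g y ∂ν - ε * ∫ p, (gibbs ε f g p - 1) ∂(μ.prod ν)

/-- Pairs at which the dual objective is finite: `f ∈ L¹(μ)`, `g ∈ L¹(ν)` and the exponential term
is integrable (for the other pairs of `L¹(μ) × L¹(ν)` the value of the objective is `-∞`). -/
structure DualFeasible {d : ℕ} (ε : ℝ) (μ ν : Measure (Euc d)) (f g : Euc d → ℝ) : Prop where
  integrable_left : Integrable f μ
  integrable_right : Integrable g ν
  integrable_gibbs : Integrable (gibbs ε f g) (μ.prod ν)

/-- `(f, g)` is a pair of extended entropic potentials from `μ` to `ν`: a maximizer of the dual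
problem over `L¹(μ) × L¹(ν)` such that
`f(x) = -ε log ∫ exp(-(½‖x - y‖² - g(y)) / ε) dν(y)` for every `x`, and
`g(y) = -ε log ∫ exp(-(½‖x - y‖² - f(x)) / ε) dμ(x)` for `ν`-almost every `y`.
The integrals are required to be finite.  (The values of `g` on a `ν`-null set, where the extension
of `g` may be infinite, are not used.) -/
structure IsEntropicPotentials {d : ℕ} (ε : ℝ) (μ ν : Measure (Euc d)) (f g : Euc d → ℝ) :
    Prop where
  feasible : DualFeasible ε μ ν f g
  optimal : ∀ f' g' : Euc d → ℝ, DualFeasible ε μ ν f' g' →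
    dualObjective ε μ ν f' g' ≤ dualObjective ε μ ν f g
  left_eq : ∀ x,
    Integrable (fun y => Real.exp (-(1 / ε) * (1 / 2 * ‖x - y‖ ^ 2 - g y))) ν ∧
    f x = -ε * Real.log (∫ y, Real.exp (-(1 / ε) * (1 / 2 * ‖x - y‖ ^ 2 - g y)) ∂ν)
  right_eq : ∀ᵐ y ∂ν,
    Integrable (fun x => Real.exp (-(1 / ε) * (1 / 2 * ‖x - y‖ ^ 2 - f x))) μ ∧
    g y = -ε * Real.log (∫ x, Real.exp (-(1 / ε) * (1 / 2 * ‖x - y‖ ^ 2 - f x)) ∂μ)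

/-- The map `x ↦ ∫ y e^{(-½‖x - y‖² + g(y)) / ε} dν(y) / ∫ e^{(-½‖x - y‖² + g(y)) / ε} dν(y)`. -/
noncomputable def barycentricMap {d : ℕ} (ε : ℝ) (ν : Measure (Euc d)) (g : Euc d → ℝ)
    (x : Euc d) : Euc d :=
  (∫ y, Real.exp (1 / ε * (-(1 / 2) * ‖x - y‖ ^ 2 + g y)) ∂ν)⁻¹ •
    ∫ y, Real.exp (1 / ε * (-(1 / 2) * ‖x - y‖ ^ 2 + g y)) • y ∂ν

open Classical in
/-- The entropic map `T^ε_{μ → ν}`: the map above for `g` the second entropic potential from `μ` to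
`ν`.  Potentials are unique up to `(f, g) ↦ (f - C, g + C)` (and null sets), which does not affect
the map, so that it does not matter which pair is chosen.  They exist for `μ` with finite second
moment and `ν` subgaussian; the value in the absence of potentials is irrelevant. -/
noncomputable def entropicMap {d : ℕ} (ε : ℝ) (μ ν : Measure (Euc d)) : Euc d → Euc d :=
  if h : ∃ g f : Euc d → ℝ, IsEntropicPotentials ε μ ν f g then barycentricMap ε ν h.choose else 0

/-- The matrix `A^ε_μ`, `[A]_{ij} = ∫ ⟨T_{μ→ν_i}(x) - x, T_{μ→ν_j}(x) - x⟩ dμ(x)`. -/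
noncomputable def entMatrix {d m : ℕ} (ε : ℝ) (μ : Measure (Euc d)) (ν : Fin m → Measure (Euc d)) :
    Matrix (Fin m) (Fin m) ℝ := fun i j =>
  ∫ x, inner ℝ (entropicMap ε μ (ν i) x - x) (entropicMap ε μ (ν j) x - x) ∂μ

/-- The matrix `S^ε_μ`,
`[S]_{ij} = ∫ ⟨T_{μ→ν_i}(x) - T_{μ→μ}(x), T_{μ→ν_j}(x) - T_{μ→μ}(x)⟩ dμ(x)`. -/
noncomputable def sinkMatrix {d m : ℕ} (ε : ℝ) (μ : Measure (Euc d))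
    (ν : Fin m → Measure (Euc d)) : Matrix (Fin m) (Fin m) ℝ := fun i j =>
  ∫ x, inner ℝ (entropicMap ε μ (ν i) x - entropicMap ε μ μ x)
    (entropicMap ε μ (ν j) x - entropicMap ε μ μ x) ∂μ

/-- `0` is an eigenvalue of `A` of multiplicity one, with eigenvector `lam` in the simplex. -/
def SimpleZeroEigenvalue {m : ℕ} (A : Matrix (Fin m) (Fin m) ℝ) (lam : Fin m → ℝ) : Prop :=
  lam ∈ stdSimplex ℝ (Fin m) ∧ A.mulVec lam = 0 ∧
    Module.finrank ℝ (Module.End.eigenspace (Matrix.toLin' A) 0) = 1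

/-- `α` is the smallest nonzero eigenvalue of `A`. -/
def IsSmallestNonzeroEigenvalue {m : ℕ} (A : Matrix (Fin m) (Fin m) ℝ) (α : ℝ) : Prop :=
  IsLeast {a : ℝ | a ≠ 0 ∧ Module.End.HasEigenvalue (Matrix.toLin' A) a} α

/-- The samples: `X k ∼ μ` and `Y j k ∼ ν j`, all of them mutually independent. -/
structure IsSample {d m : ℕ} {S : Type*} [MeasurableSpace S] (P : Measure S)
    (μ : Measure (Euc d)) (ν : Fin m → Measure (Euc d))
    (X : ℕ → S → Euc d) (Y : Fin m → ℕ → S → Euc d) : Prop where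
  law_X : ∀ k, HasLaw (X k) μ P
  law_Y : ∀ j k, HasLaw (Y j k) (ν j) P
  indep : iIndepFun (Sum.elim X (fun p : Fin m × ℕ => Y p.1 p.2)) P

/-- The first `n` terms of a sequence. -/
def firstBatch {β : Type*} (n : ℕ) (z : ℕ → β) : Fin n → β := fun k => z k

/-- The next `n` terms of a sequence, i.e. the terms `n + 1, …, 2n` when counting from one. -/
def secondBatch {β : Type*} (n : ℕ) (z : ℕ → β) : Fin n → β := fun k => z (n + k)

/-- The expected squared `L²(μ)` error `E ‖T - T̂‖²_{L²(μ)}` of a random map `That`. -/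
noncomputable def expectedSqError {d : ℕ} {S : Type*} [MeasurableSpace S] (P : Measure S)
    (μ : Measure (Euc d)) (T : Euc d → Euc d) (That : S → Euc d → Euc d) : ℝ≥0∞ :=
  ∫⁻ s, ∫⁻ x, ENNReal.ofReal (‖T x - That s x‖ ^ 2) ∂μ ∂P

/-- The matrix of the coefficient recovery algorithm for the entropic barycenter functional:
`n⁻¹ ∑_k ⟨T̂_i(x_k) - x_k, T̂_j(x_k) - x_k⟩`. -/
noncomputable def entMatrixHat {d m n : ℕ} (That : Fin m → Euc d → Euc d) (x : Fin n → Euc d) :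
    Matrix (Fin m) (Fin m) ℝ := fun i j =>
  (n : ℝ)⁻¹ * ∑ k, inner ℝ (That i (x k) - x k) (That j (x k) - x k)

/-- The matrix of the coefficient recovery algorithm for the Sinkhorn barycenter functional:
`n⁻¹ ∑_k ⟨T̂_i(x_k) - T̂(x_k), T̂_j(x_k) - T̂(x_k)⟩`. -/
noncomputable def sinkMatrixHat {d m n : ℕ} (That : Fin m → Euc d → Euc d)
    (That0 : Euc d → Euc d) (x : Fin n → Euc d) : Matrix (Fin m) (Fin m) ℝ := fun i j =>
  (n : ℝ)⁻¹ * ∑ k, inner ℝ (That i (x k) - That0 (x k)) (That j (x k) - That0 (x k))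

/-- `lam ∈ argmin_{κ ∈ Δ^m} κᵀ M κ`. -/
def IsSimplexMinimizer {m : ℕ} (M : Matrix (Fin m) (Fin m) ℝ) (lam : Fin m → ℝ) : Prop :=
  lam ∈ stdSimplex ℝ (Fin m) ∧
    IsMinOn (fun κ : Fin m → ℝ => dotProduct κ (M.mulVec κ)) (stdSimplex ℝ (Fin m)) lam

/-!
The constant `80` works in both cases.

Write `u j` for the vector field `T_{μ → ν_j} - R`, where `R` is the identity or `T_{μ → μ}`.  The
matrix `A` of the problem is the Gram matrix of the `u j` in `L²(μ)`, so it is symmetric positive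
semidefinite, and its simple kernel is spanned by `lam`.

*Deterministic part.*  Split a point `kap` of the simplex as `a lam + r` with `r ⟂ lam`.  The entries
of `kap - lam` sum to zero, so `‖kap - lam‖² ≤ (m + 1) ‖r‖²`, and the spectral gap gives
`α₂ ‖r‖² ≤ kapᵀ A kap` (`sq_dist_le_quadForm`).  A minimizer for a perturbation `M` of `A` therefore
lies within squared distance `2 (m + 1) / α₂ * ∑ |A i j - M i j|` of `lam` (`sq_dist_minimizer_le`).

*Moments.*  The map `T_{μ → ν}` is the conditional mean of the Gibbs coupling, whose second marginal
is `ν`; by Jensen, `∫ ‖T‖⁴ dμ ≤ ∫ ‖y‖⁴ dν ≤ 2 (d σ²)²` (`lintegral_entropicMap_pow_four_le`).  In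
the entropic case nothing is assumed on the size of `μ` beyond a finite second moment, but `A lam = 0`
says that `x = ∑ lam j • T_{μ → ν_j} x` for `μ`-a.e. `x`, and convexity bounds the fourth moment of
`μ` too (`lintegral_norm_pow_four_le_of_convex_combination`).

*Sampling.*  Let `K = d σ²`.  An entry of the empirical matrix differs from the true one by the effect
of replacing the fields by their estimates, of order `√(K θ) + θ` by Cauchy–Schwarz since the first
batch is independent of the second, and by the fluctuation of an empirical mean, of order `K / √n`
by the variance bound (`lintegral_empirical_inner_sub_le`).  Summing over the `m²` entries gives the
claim.
-/

/-! ### The smallest nonzero eigenvalue controls the distance to the kernel -/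

lemma dotProduct_mulVec_of_isHermitian {m : ℕ} {A : Matrix (Fin m) (Fin m) ℝ} (hA : A.IsHermitian)
    (x y : Fin m → ℝ) : dotProduct x (A.mulVec y) = dotProduct (A.mulVec x) y := by
  have hAt : A.transpose = A := by simpa [Matrix.IsHermitian] using hA
  rw [Matrix.dotProduct_mulVec, ← Matrix.mulVec_transpose, hAt]

lemma ne_zero_of_mem_stdSimplex {m : ℕ} {lam : Fin m → ℝ} (h : lam ∈ stdSimplex ℝ (Fin m)) :
    lam ≠ 0 := by
  rintro rfl
  simpa using h.2

/-- Spectral gap: a symmetric matrix with kernel `ℝ lam` has quadratic form at least `α ‖v‖²` on the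
orthogonal complement of `lam`, where `α` is its smallest nonzero eigenvalue. -/
lemma spectral_gap {m : ℕ} {A : Matrix (Fin m) (Fin m) ℝ} {lam : Fin m → ℝ} {α : ℝ}
    (hA : A.IsHermitian) (hlam : SimpleZeroEigenvalue A lam)
    (hα : IsSmallestNonzeroEigenvalue A α) {v : Fin m → ℝ} (hv : dotProduct lam v = 0) :
    α * dotProduct v v ≤ dotProduct v (A.mulVec v) := by
  classical
  have hsymm := dotProduct_mulVec_of_isHermitian hA
  have hlam0 := ne_zero_of_mem_stdSimplex hlam.1
  set b := hA.eigenvectorBasis with hb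
  have hexp : ∀ x y : Fin m → ℝ,
      dotProduct x y = ∑ i, dotProduct (b i).ofLp x * dotProduct (b i).ofLp y := by
    intro x y
    have h := b.sum_inner_mul_inner (WithLp.toLp 2 x) (WithLp.toLp 2 y)
    simp only [EuclideanSpace.inner_eq_star_dotProduct, star_trivial] at h
    rw [dotProduct_comm x y, ← h]
    exact Finset.sum_congr rfl fun i _ => by rw [dotProduct_comm y]
  rw [hexp v v, hexp v (A.mulVec v), Finset.mul_sum]
  refine Finset.sum_le_sum fun i _ => ?_
  have hbi : A.mulVec (b i).ofLp = hA.eigenvalues i • (b i).ofLp := hA.mulVec_eigenvectorBasis i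
  have hne : (b i).ofLp ≠ 0 := by
    intro h
    have h1 := b.orthonormal.1 i
    rw [show b i = 0 from (WithLp.ofLp_eq_zero 2).1 h] at h1
    simp at h1
  rw [hsymm, hbi, smul_dotProduct, smul_eq_mul]
  by_cases h0 : hA.eigenvalues i = 0
  · -- an eigenvector for the eigenvalue `0` is a multiple of `lam`, hence orthogonal to `v`
    obtain ⟨w, -, hw⟩ := finrank_eq_one_iff'.1 hlam.2.2
    have memE : ∀ x : Fin m → ℝ, A.mulVec x = 0 →
        x ∈ Module.End.eigenspace (Matrix.toLin' A) 0 := by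
      intro x hx
      simp [Matrix.toLin'_apply, hx]
    obtain ⟨c, hc⟩ := hw ⟨lam, memE _ hlam.2.1⟩
    obtain ⟨c', hc'⟩ := hw ⟨(b i).ofLp, memE _ (by rw [hbi, h0, zero_smul])⟩
    have hc1 : c • (w : Fin m → ℝ) = lam := congrArg Subtype.val hc
    have hc2 : c' • (w : Fin m → ℝ) = (b i).ofLp := congrArg Subtype.val hc'
    have hc0 : c ≠ 0 := by
      rintro rfl
      exact hlam0 (by rw [← hc1, zero_smul])
    have hwv : dotProduct (w : Fin m → ℝ) v = 0 := by
      rw [← hc1, smul_dotProduct, smul_eq_mul] at hv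
      exact (mul_eq_zero.1 hv).resolve_left hc0
    rw [← hc2, smul_dotProduct, hwv]
    simp
  · have hle : α ≤ hA.eigenvalues i := by
      refine hα.2 ⟨h0, Module.End.hasEigenvalue_of_hasEigenvector (x := (b i).ofLp) ⟨?_, hne⟩⟩
      rw [Module.End.mem_eigenspace_iff, Matrix.toLin'_apply, hbi]
    nlinarith [mul_self_nonneg (dotProduct (b i).ofLp v)]

lemma smallest_eigenvalue_pos {m : ℕ} {A : Matrix (Fin m) (Fin m) ℝ} {α : ℝ}
    (hpsd : ∀ v : Fin m → ℝ, 0 ≤ dotProduct v (A.mulVec v))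
    (hα : IsSmallestNonzeroEigenvalue A α) : 0 < α := by
  obtain ⟨h0, hev⟩ := hα.1
  obtain ⟨v, hv⟩ := hev.exists_hasEigenvector
  have h1 := hpsd v
  have h2 : A.mulVec v = α • v := by
    simpa [Matrix.toLin'_apply] using hv.apply_eq_smul
  rw [h2, dotProduct_smul, smul_eq_mul] at h1
  have h3 : 0 < dotProduct v v := by
    have : 0 ≤ dotProduct v v := Finset.sum_nonneg fun i _ => mul_self_nonneg _
    refine lt_of_le_of_ne this fun h => hv.2 (dotProduct_self_eq_zero.1 h.symm)
  exact lt_of_le_of_ne (nonneg_of_mul_nonneg_left h1 h3) (Ne.symm h0)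

/-- The squared distance from `lam` to a point `kap` of the simplex is at most `m + 1` times the
squared norm of the component of `kap` orthogonal to `lam`, since the entries of `kap - lam` sum to
zero; the spectral gap controls that component. -/
lemma sq_dist_le_quadForm {m : ℕ} {A : Matrix (Fin m) (Fin m) ℝ} {lam kap : Fin m → ℝ} {α : ℝ}
    (hA : A.IsHermitian) (hpsd : ∀ v : Fin m → ℝ, 0 ≤ dotProduct v (A.mulVec v))
    (hlam : SimpleZeroEigenvalue A lam) (hα : IsSmallestNonzeroEigenvalue A α)
    (hkap : kap ∈ stdSimplex ℝ (Fin m)) :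
    ∑ i, (kap i - lam i) ^ 2 ≤ (m + 1) / α * dotProduct kap (A.mulVec kap) := by
  have hα0 := smallest_eigenvalue_pos hpsd hα
  have hsymm := dotProduct_mulVec_of_isHermitian hA
  have hlam0 := ne_zero_of_mem_stdSimplex hlam.1
  have hL : 0 < dotProduct lam lam := by
    have : 0 ≤ dotProduct lam lam := Finset.sum_nonneg fun i _ => mul_self_nonneg _
    exact lt_of_le_of_ne this fun h => hlam0 (dotProduct_self_eq_zero.1 h.symm)
  have hL1 : dotProduct lam lam ≤ 1 := by
    rw [← hlam.1.2]
    refine Finset.sum_le_sum fun i _ => ?_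
    have h1 : lam i ≤ 1 := (mem_Icc_of_mem_stdSimplex hlam.1 i).2
    nlinarith [hlam.1.1 i]
  set a : ℝ := dotProduct lam kap / dotProduct lam lam with ha
  set r : Fin m → ℝ := kap - a • lam with hr
  have hkr : kap = a • lam + r := by simp [hr]
  have hlr : dotProduct lam r = 0 := by
    rw [hr, dotProduct_sub, dotProduct_smul, smul_eq_mul, ha]
    field_simp
    ring
  have hQ : dotProduct kap (A.mulVec kap) = dotProduct r (A.mulVec r) := by
    have h1 : A.mulVec kap = A.mulVec r := by
      rw [hkr, Matrix.mulVec_add, Matrix.mulVec_smul, hlam.2.1]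
      simp
    rw [h1, hsymm, h1, ← hsymm]
  have hgap := spectral_gap hA hlam hα hlr
  have hsum : ∑ i, r i = 1 - a := by
    have h1 : ∑ i, r i = ∑ i, kap i - a * ∑ i, lam i := by
      simp [hr, Finset.sum_sub_distrib, Finset.mul_sum]
    rw [h1, hkap.2, hlam.1.2, mul_one]
  have hcs : (1 - a) ^ 2 ≤ m * dotProduct r r := by
    rw [← hsum]
    have := sq_sum_le_card_mul_sum_sq (s := Finset.univ) (f := r)
    simpa [dotProduct, sq] using this
  have hmain : ∑ i, (kap i - lam i) ^ 2 = (1 - a) ^ 2 * dotProduct lam lam + dotProduct r r := by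
    have h1 : ∀ i, (kap i - lam i) ^ 2
        = (1 - a) ^ 2 * (lam i * lam i) - 2 * (1 - a) * (lam i * r i) + r i * r i := by
      intro i
      have : kap i = a * lam i + r i := by simp [hr]
      rw [this]; ring
    rw [Finset.sum_congr rfl fun i _ => h1 i, Finset.sum_add_distrib, Finset.sum_sub_distrib,
      ← Finset.mul_sum, ← Finset.mul_sum]
    have h2 : ∑ i, lam i * r i = 0 := hlr
    rw [h2]
    simp [dotProduct]
  have hfin : ∑ i, (kap i - lam i) ^ 2 ≤ (m + 1) * dotProduct r r := by
    rw [hmain]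
    nlinarith [sq_nonneg (1 - a)]
  calc ∑ i, (kap i - lam i) ^ 2 ≤ (m + 1) * dotProduct r r := hfin
    _ = (m + 1) / α * (α * dotProduct r r) := by field_simp
    _ ≤ (m + 1) / α * dotProduct kap (A.mulVec kap) := by
      rw [hQ]
      gcongr

lemma abs_quadForm_sub_le {m : ℕ} (A M : Matrix (Fin m) (Fin m) ℝ) {kap : Fin m → ℝ}
    (hkap : kap ∈ stdSimplex ℝ (Fin m)) :
    |dotProduct kap (A.mulVec kap) - dotProduct kap (M.mulVec kap)|
      ≤ ∑ i, ∑ j, |A i j - M i j| := by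
  have h1 : dotProduct kap (A.mulVec kap) - dotProduct kap (M.mulVec kap)
      = ∑ i, ∑ j, kap i * kap j * (A i j - M i j) := by
    simp only [dotProduct, Matrix.mulVec, Finset.mul_sum, ← Finset.sum_sub_distrib]
    exact Finset.sum_congr rfl fun i _ => Finset.sum_congr rfl fun j _ => by ring
  rw [h1]
  refine (Finset.abs_sum_le_sum_abs _ _).trans (Finset.sum_le_sum fun i _ => ?_)
  refine (Finset.abs_sum_le_sum_abs _ _).trans (Finset.sum_le_sum fun j _ => ?_)
  have hi := mem_Icc_of_mem_stdSimplex hkap i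
  have hj := mem_Icc_of_mem_stdSimplex hkap j
  rw [abs_mul, abs_of_nonneg (mul_nonneg hi.1 hj.1)]
  exact mul_le_of_le_one_left (abs_nonneg _) (mul_le_one₀ hi.2 hj.1 hj.2)

/-- Stability of the minimizer: if `A lam = 0`, then a minimizer over the simplex of the quadratic
form of a perturbation `M` of `A` is close to `lam`. -/
lemma sq_dist_minimizer_le {m : ℕ} {A M : Matrix (Fin m) (Fin m) ℝ} {lam kap : Fin m → ℝ} {α : ℝ}
    (hA : A.IsHermitian) (hpsd : ∀ v : Fin m → ℝ, 0 ≤ dotProduct v (A.mulVec v))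
    (hlam : SimpleZeroEigenvalue A lam) (hα : IsSmallestNonzeroEigenvalue A α)
    (hkap : IsSimplexMinimizer M kap) :
    ∑ i, (kap i - lam i) ^ 2 ≤ 2 * (m + 1) / α * ∑ i, ∑ j, |A i j - M i j| := by
  have hα0 := smallest_eigenvalue_pos hpsd hα
  have h1 := sq_dist_le_quadForm hA hpsd hlam hα hkap.1
  have h2 := abs_le.1 (abs_quadForm_sub_le A M hkap.1)
  have h3 := abs_le.1 (abs_quadForm_sub_le A M hlam.1)
  have h4 : dotProduct kap (M.mulVec kap) ≤ dotProduct lam (M.mulVec lam) := hkap.2 hlam.1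
  have h5 : dotProduct lam (A.mulVec lam) = 0 := by rw [hlam.2.1, dotProduct_zero]
  calc ∑ i, (kap i - lam i) ^ 2 ≤ (m + 1) / α * dotProduct kap (A.mulVec kap) := h1
    _ ≤ (m + 1) / α * (2 * ∑ i, ∑ j, |A i j - M i j|) := by
      gcongr
      linarith [h2.2, h3.1]
    _ = 2 * (m + 1) / α * ∑ i, ∑ j, |A i j - M i j| := by ring

/-! ### Fourth moments of entropic maps -/

lemma sq_lintegral_mul_le {α : Type*} [MeasurableSpace α] (μ : Measure α) {f g : α → ℝ≥0∞}
    (hf : AEMeasurable f μ) (hg : AEMeasurable g μ) :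
    (∫⁻ a, f a * g a ∂μ) ^ 2 ≤ (∫⁻ a, f a ^ 2 ∂μ) * ∫⁻ a, g a ^ 2 ∂μ := by
  have h := ENNReal.lintegral_mul_le_Lp_mul_Lq μ Real.HolderConjugate.two_two hf hg
  have h2 : ∀ x : ℝ≥0∞, (x ^ (1 / 2 : ℝ)) ^ 2 = x := by
    intro x
    rw [← ENNReal.rpow_natCast, ← ENNReal.rpow_mul]
    norm_num
  calc (∫⁻ a, f a * g a ∂μ) ^ 2
      ≤ ((∫⁻ a, f a ^ (2 : ℝ) ∂μ) ^ (1 / 2 : ℝ) * (∫⁻ a, g a ^ (2 : ℝ) ∂μ) ^ (1 / 2 : ℝ)) ^ 2 := by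
        gcongr
        exact h
    _ = _ := by
      rw [mul_pow, h2, h2]
      simp

/-- Jensen's inequality for the square, with respect to the probability density `p`. -/
lemma sq_lintegral_weighted_le {α : Type*} [MeasurableSpace α] (μ : Measure α) {p h : α → ℝ≥0∞}
    (hp : AEMeasurable p μ) (hh : AEMeasurable h μ) (h1 : ∫⁻ a, p a ∂μ = 1) :
    (∫⁻ a, p a * h a ∂μ) ^ 2 ≤ ∫⁻ a, p a * h a ^ 2 ∂μ := by
  have h2 : ∀ x : ℝ≥0∞, x ^ (1 / 2 : ℝ) * x ^ (1 / 2 : ℝ) = x := by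
    intro x
    rw [← ENNReal.rpow_add_of_nonneg _ _ (by norm_num) (by norm_num)]
    norm_num
  have h := sq_lintegral_mul_le μ (hp.pow_const (1 / 2 : ℝ)) ((hp.pow_const (1 / 2 : ℝ)).mul hh)
  simpa only [Pi.mul_apply, ← mul_assoc, h2, mul_pow, sq (_ ^ (1 / 2 : ℝ)), h1, one_mul] using h

lemma pow_four_lintegral_weighted_le {α : Type*} [MeasurableSpace α] (μ : Measure α)
    {p h : α → ℝ≥0∞} (hp : AEMeasurable p μ) (hh : AEMeasurable h μ) (h1 : ∫⁻ a, p a ∂μ = 1) :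
    (∫⁻ a, p a * h a ∂μ) ^ 4 ≤ ∫⁻ a, p a * h a ^ 4 ∂μ := by
  have e1 := sq_lintegral_weighted_le μ hp hh h1
  have e2 := sq_lintegral_weighted_le μ hp (hh.pow_const 2) h1
  calc (∫⁻ a, p a * h a ∂μ) ^ 4 = ((∫⁻ a, p a * h a ∂μ) ^ 2) ^ 2 := by rw [← pow_mul]
    _ ≤ (∫⁻ a, p a * h a ^ 2 ∂μ) ^ 2 := by gcongr
    _ ≤ ∫⁻ a, p a * (h a ^ 2) ^ 2 ∂μ := e2
    _ = ∫⁻ a, p a * h a ^ 4 ∂μ := by simp only [← pow_mul]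

lemma measurable_barycentricMap {d : ℕ} (ε : ℝ) (ν : Measure (Euc d)) [SFinite ν] {g : Euc d → ℝ}
    (hg : AEStronglyMeasurable g ν) : Measurable (barycentricMap ε ν g) := by
  -- the integrals only see the `ν`-class of `g`, so `g` may be taken measurable
  have heq : barycentricMap ε ν g = barycentricMap ε ν (hg.mk g) := by
    funext x
    have h1 : (∫ y, Real.exp (1 / ε * (-(1 / 2) * ‖x - y‖ ^ 2 + g y)) ∂ν)
        = ∫ y, Real.exp (1 / ε * (-(1 / 2) * ‖x - y‖ ^ 2 + hg.mk g y)) ∂ν :=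
      integral_congr_ae (hg.ae_eq_mk.mono fun y hy => by simp only [hy])
    have h2 : (∫ y, Real.exp (1 / ε * (-(1 / 2) * ‖x - y‖ ^ 2 + g y)) • y ∂ν)
        = ∫ y, Real.exp (1 / ε * (-(1 / 2) * ‖x - y‖ ^ 2 + hg.mk g y)) • y ∂ν :=
      integral_congr_ae (hg.ae_eq_mk.mono fun y hy => by simp only [hy])
    rw [barycentricMap, barycentricMap, h1, h2]
  have hm : Measurable (hg.mk g) := hg.stronglyMeasurable_mk.measurable
  have hw : Measurable fun q : Euc d × Euc d =>
      Real.exp (1 / ε * (-(1 / 2) * ‖q.1 - q.2‖ ^ 2 + hg.mk g q.2)) := by fun_prop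
  rw [heq]
  unfold barycentricMap
  have h1 := (hw.stronglyMeasurable.integral_prod_right' (ν := ν)).measurable
  have h2 := ((hw.smul measurable_snd).stronglyMeasurable.integral_prod_right' (ν := ν)).measurable
  exact h1.inv.smul h2

section Potentials

variable {d : ℕ} {ε : ℝ} {μ ν : Measure (Euc d)} {f g : Euc d → ℝ}

lemma gibbs_eq_left (ε : ℝ) (f g : Euc d → ℝ) (x y : Euc d) :
    gibbs ε f g (x, y)
      = Real.exp (f x / ε) * Real.exp (-(1 / ε) * (1 / 2 * ‖x - y‖ ^ 2 - g y)) := by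
  rw [gibbs, ← Real.exp_add]
  congr 1
  ring

lemma gibbs_eq_right (ε : ℝ) (f g : Euc d → ℝ) (x y : Euc d) :
    gibbs ε f g (x, y)
      = Real.exp (g y / ε) * Real.exp (-(1 / ε) * (1 / 2 * ‖x - y‖ ^ 2 - f x)) := by
  rw [gibbs, ← Real.exp_add]
  congr 1
  ring

/-- The normalization shared by both marginal equations of the Gibbs density. -/
lemma exp_div_mul_integral_eq_one {α : Type*} [MeasurableSpace α] {ρ : Measure α}
    [IsProbabilityMeasure ρ] (hε : 0 < ε) {h : α → ℝ} {c : ℝ}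
    (hi : Integrable (fun a => Real.exp (h a)) ρ)
    (hc : c = -ε * Real.log (∫ a, Real.exp (h a) ∂ρ)) :
    Real.exp (c / ε) * ∫ a, Real.exp (h a) ∂ρ = 1 := by
  have hpos : 0 < ∫ a, Real.exp (h a) ∂ρ := integral_exp_pos hi
  have h1 : c / ε = -Real.log (∫ a, Real.exp (h a) ∂ρ) := by
    rw [hc]
    field_simp
  rw [h1, Real.exp_neg, Real.exp_log hpos, inv_mul_cancel₀ hpos.ne']

lemma lintegral_gibbs_right [IsProbabilityMeasure ν] (hε : 0 < ε)
    (h : IsEntropicPotentials ε μ ν f g) (x : Euc d) :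
    ∫⁻ y, ENNReal.ofReal (gibbs ε f g (x, y)) ∂ν = 1 := by
  obtain ⟨hi, hf⟩ := h.left_eq x
  simp only [gibbs_eq_left]
  rw [← ofReal_integral_eq_lintegral_ofReal (hi.const_mul _)
    (Filter.Eventually.of_forall fun y => by positivity), integral_const_mul,
    exp_div_mul_integral_eq_one hε hi hf, ENNReal.ofReal_one]

lemma lintegral_gibbs_left [IsProbabilityMeasure μ] (hε : 0 < ε)
    (h : IsEntropicPotentials ε μ ν f g) :
    ∀ᵐ y ∂ν, ∫⁻ x, ENNReal.ofReal (gibbs ε f g (x, y)) ∂μ = 1 := by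
  filter_upwards [h.right_eq] with y hy
  obtain ⟨hi, hg⟩ := hy
  simp only [gibbs_eq_right]
  rw [← ofReal_integral_eq_lintegral_ofReal (hi.const_mul _)
    (Filter.Eventually.of_forall fun y => by positivity), integral_const_mul,
    exp_div_mul_integral_eq_one hε hi hg, ENNReal.ofReal_one]

/-- The barycentric map is the mean of `y` under the conditional Gibbs density given `x`. -/
lemma barycentricMap_eq_integral_gibbs [IsProbabilityMeasure ν] (hε : 0 < ε)
    (h : IsEntropicPotentials ε μ ν f g) (x : Euc d) :
    barycentricMap ε ν g x = ∫ y, gibbs ε f g (x, y) • y ∂ν := by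
  obtain ⟨hi, hf⟩ := h.left_eq x
  have h1 := exp_div_mul_integral_eq_one hε hi hf
  have h2 : ∀ y, 1 / ε * (-(1 / 2) * ‖x - y‖ ^ 2 + g y)
      = -(1 / ε) * (1 / 2 * ‖x - y‖ ^ 2 - g y) := fun y => by ring
  simp only [barycentricMap, gibbs_eq_left, h2, mul_smul, integral_smul]
  rw [eq_inv_of_mul_eq_one_left h1]

/-- The second marginal of the Gibbs coupling is `ν`, so Jensen's inequality bounds the fourth
moment of the map by that of `ν`. -/
lemma lintegral_barycentricMap_pow_four_le [IsProbabilityMeasure μ] [IsProbabilityMeasure ν]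
    (hε : 0 < ε) (h : IsEntropicPotentials ε μ ν f g) :
    ∫⁻ x, ‖barycentricMap ε ν g x‖ₑ ^ 4 ∂μ ≤ ∫⁻ y, ‖y‖ₑ ^ 4 ∂ν := by
  have hgm : AEMeasurable g ν := h.feasible.integrable_right.aemeasurable
  have hpm : ∀ x, AEMeasurable (fun y => ENNReal.ofReal (gibbs ε f g (x, y))) ν := by
    intro x
    simp only [gibbs]
    fun_prop
  have hjoint : AEMeasurable (fun q : Euc d × Euc d =>
      ENNReal.ofReal (gibbs ε f g q) * ‖q.2‖ₑ ^ 4) (μ.prod ν) :=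
    h.feasible.integrable_gibbs.aemeasurable.ennreal_ofReal.mul
      (measurable_snd.enorm.pow_const 4).aemeasurable
  calc ∫⁻ x, ‖barycentricMap ε ν g x‖ₑ ^ 4 ∂μ
      ≤ ∫⁻ x, ∫⁻ y, ENNReal.ofReal (gibbs ε f g (x, y)) * ‖y‖ₑ ^ 4 ∂ν ∂μ := by
        refine lintegral_mono fun x => ?_
        refine le_trans ?_ (pow_four_lintegral_weighted_le ν (hpm x)
          measurable_enorm.aemeasurable (lintegral_gibbs_right hε h x))
        gcongr
        rw [barycentricMap_eq_integral_gibbs hε h]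
        refine (enorm_integral_le_lintegral_enorm _).trans (lintegral_mono fun y => ?_)
        rw [enorm_smul, Real.enorm_of_nonneg (by unfold gibbs; positivity)]
    _ = ∫⁻ y, ∫⁻ x, ENNReal.ofReal (gibbs ε f g (x, y)) * ‖y‖ₑ ^ 4 ∂μ ∂ν :=
        lintegral_lintegral_swap hjoint
    _ = ∫⁻ y, ‖y‖ₑ ^ 4 ∂ν := by
        refine lintegral_congr_ae ?_
        filter_upwards [lintegral_gibbs_left hε h] with y hy
        rw [lintegral_mul_const' _ _ (by finiteness), hy, one_mul]

end Potentials

lemma lintegral_coord_pow_four_le {d : ℕ} {Ω : Set (Euc d)} {σ : ℝ} {ν : Measure (Euc d)}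
    (h : IsSubgaussian Ω σ ν) (i : Fin d) :
    ∫⁻ y, ENNReal.ofReal (y i ^ 4) ∂ν ≤ ENNReal.ofReal (2 * σ ^ 4) := by
  have := h.isProb
  have hσ := h.sigma_pos
  have h1 := h.exp_moment (EuclideanSpace.single i 1) (by simp)
  have h2 : ∀ y : Euc d, ENNReal.ofReal ((2 * σ ^ 4)⁻¹ * y i ^ 4) + 1 ≤
      ENNReal.ofReal (Real.exp ((inner ℝ y (EuclideanSpace.single i (1 : ℝ))) ^ 2 / σ ^ 2)) := by
    intro y
    rw [← ENNReal.ofReal_one, ← ENNReal.ofReal_add (by positivity) (by norm_num)]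
    refine ENNReal.ofReal_le_ofReal ?_
    have h3 : inner ℝ y (EuclideanSpace.single i (1 : ℝ)) = y i := by
      simp [EuclideanSpace.inner_single_right]
    rw [h3]
    have ht : 0 ≤ y i ^ 2 / σ ^ 2 := by positivity
    have h4 := Real.quadratic_le_exp_of_nonneg ht
    have h5 : (2 * σ ^ 4)⁻¹ * y i ^ 4 = (y i ^ 2 / σ ^ 2) ^ 2 / 2 := by
      field_simp
    rw [h5]
    linarith
  have h3 : ∫⁻ y, ENNReal.ofReal ((2 * σ ^ 4)⁻¹ * y i ^ 4) ∂ν + 1 ≤ 1 + 1 := by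
    calc ∫⁻ y, ENNReal.ofReal ((2 * σ ^ 4)⁻¹ * y i ^ 4) ∂ν + 1
        = ∫⁻ y, (ENNReal.ofReal ((2 * σ ^ 4)⁻¹ * y i ^ 4) + 1) ∂ν := by
          rw [lintegral_add_right _ measurable_const]
          simp
      _ ≤ 2 := (lintegral_mono h2).trans h1
      _ = 1 + 1 := by norm_num
  have h4 := ENNReal.le_of_add_le_add_right ENNReal.one_ne_top h3
  have hc : (0 : ℝ) < 2 * σ ^ 4 := by positivity
  calc ∫⁻ y, ENNReal.ofReal (y i ^ 4) ∂ν
      = ∫⁻ y, ENNReal.ofReal (2 * σ ^ 4) * ENNReal.ofReal ((2 * σ ^ 4)⁻¹ * y i ^ 4) ∂ν := by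
        refine lintegral_congr fun y => ?_
        rw [← ENNReal.ofReal_mul hc.le, mul_inv_cancel_left₀ hc.ne']
    _ = ENNReal.ofReal (2 * σ ^ 4) * ∫⁻ y, ENNReal.ofReal ((2 * σ ^ 4)⁻¹ * y i ^ 4) ∂ν :=
        lintegral_const_mul' _ _ ENNReal.ofReal_ne_top
    _ ≤ ENNReal.ofReal (2 * σ ^ 4) * 1 := by gcongr
    _ = _ := mul_one _

lemma IsSubgaussian.lintegral_norm_pow_four_le {d : ℕ} {Ω : Set (Euc d)} {σ : ℝ}
    {ν : Measure (Euc d)} (h : IsSubgaussian Ω σ ν) :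
    ∫⁻ y, ‖y‖ₑ ^ 4 ∂ν ≤ ENNReal.ofReal (2 * (d * σ ^ 2) ^ 2) := by
  have h1 : ∀ y : Euc d, ‖y‖ₑ ^ 4 ≤ ENNReal.ofReal d * ∑ i, ENNReal.ofReal (y i ^ 4) := by
    intro y
    rw [← ENNReal.ofReal_sum_of_nonneg fun i _ => by positivity,
      ← ENNReal.ofReal_mul (by positivity), ← ofReal_norm, ← ENNReal.ofReal_pow (norm_nonneg _)]
    refine ENNReal.ofReal_le_ofReal ?_
    have h2 : ‖y‖ ^ 4 = (∑ i, y i ^ 2) ^ 2 := by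
      rw [← EuclideanSpace.real_norm_sq_eq, ← pow_mul]
    rw [h2]
    have := sq_sum_le_card_mul_sum_sq (s := Finset.univ) (f := fun i => y i ^ 2)
    simpa [← pow_mul] using this
  calc ∫⁻ y, ‖y‖ₑ ^ 4 ∂ν ≤ ∫⁻ y, ENNReal.ofReal d * ∑ i, ENNReal.ofReal (y i ^ 4) ∂ν :=
        lintegral_mono h1
    _ = ENNReal.ofReal d * ∑ i, ∫⁻ y, ENNReal.ofReal (y i ^ 4) ∂ν := by
        rw [lintegral_const_mul' _ _ ENNReal.ofReal_ne_top, lintegral_finsetSum]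
        intro i _
        fun_prop
    _ ≤ ENNReal.ofReal d * ∑ _i : Fin d, ENNReal.ofReal (2 * σ ^ 4) := by
        gcongr with i
        exact lintegral_coord_pow_four_le h i
    _ = ENNReal.ofReal (2 * (d * σ ^ 2) ^ 2) := by
        rw [← ENNReal.ofReal_sum_of_nonneg fun i _ => by positivity,
          ← ENNReal.ofReal_mul (by positivity)]
        congr 1
        simp
        ring

lemma measurable_entropicMap {d : ℕ} (ε : ℝ) (μ ν : Measure (Euc d)) [SFinite ν] :
    Measurable (entropicMap ε μ ν) := by
  unfold entropicMap
  split_ifs with h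
  · obtain ⟨f, hf⟩ := h.choose_spec
    exact measurable_barycentricMap ε ν hf.feasible.integrable_right.aestronglyMeasurable
  · exact measurable_const

lemma lintegral_entropicMap_pow_four_le {d : ℕ} {ε : ℝ} (hε : 0 < ε) {Ω : Set (Euc d)} {σ : ℝ}
    {μ ν : Measure (Euc d)} [IsProbabilityMeasure μ] (hν : IsSubgaussian Ω σ ν) :
    ∫⁻ x, ‖entropicMap ε μ ν x‖ₑ ^ 4 ∂μ ≤ ENNReal.ofReal (2 * (d * σ ^ 2) ^ 2) := by
  have := hν.isProb
  refine le_trans ?_ hν.lintegral_norm_pow_four_le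
  unfold entropicMap
  split_ifs with h
  · obtain ⟨f, hf⟩ := h.choose_spec
    exact lintegral_barycentricMap_pow_four_le hε hf
  · simp

/-! ### Gram matrices of square integrable vector fields -/

lemma memLp_two_of_lintegral_sq_lt_top {α F : Type*} [MeasurableSpace α] [NormedAddCommGroup F]
    {μ : Measure α} {f : α → F} (hf : AEStronglyMeasurable f μ)
    (h : ∫⁻ a, ‖f a‖ₑ ^ 2 ∂μ < ∞) : MemLp f 2 μ := by
  refine ⟨hf, ?_⟩
  rw [eLpNorm_lt_top_iff_lintegral_rpow_enorm_lt_top (by norm_num) (by norm_num)]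
  simpa using h

lemma lintegral_sq_le_of_pow_four_le {α : Type*} [MeasurableSpace α] {μ : Measure α}
    [IsProbabilityMeasure μ] {h : α → ℝ≥0∞} (hh : AEMeasurable h μ) {B : ℝ} (hB : 0 ≤ B)
    (h4 : ∫⁻ a, h a ^ 4 ∂μ ≤ ENNReal.ofReal (B ^ 2)) :
    ∫⁻ a, h a ^ 2 ∂μ ≤ ENNReal.ofReal B := by
  have h1 := sq_lintegral_mul_le μ (aemeasurable_const (b := (1 : ℝ≥0∞))) (hh.pow_const 2)
  simp only [one_mul, one_pow, lintegral_const, measure_univ, mul_one, ← pow_mul] at h1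
  rw [ENNReal.ofReal_pow hB] at h4
  exact (ENNReal.pow_le_pow_left_iff two_ne_zero).1 (h1.trans h4)

section Gram

/-- The Gram matrix `∫ ⟪u_i, u_j⟫ dμ` of a family of vector fields in `L²(μ)`. -/
noncomputable def gramMatrix {d m : ℕ} (μ : Measure (Euc d)) (u : Fin m → Euc d → Euc d) :
    Matrix (Fin m) (Fin m) ℝ := fun i j => ∫ x, inner ℝ (u i x) (u j x) ∂μ

variable {d m : ℕ} {μ : Measure (Euc d)} {u : Fin m → Euc d → Euc d}

lemma quadForm_gram (hu : ∀ i, MemLp (u i) 2 μ) (v : Fin m → ℝ) :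
    dotProduct v ((gramMatrix μ u).mulVec v)
      = ∫ x, ‖∑ i, v i • u i x‖ ^ 2 ∂μ := by
  have hint : ∀ i j, Integrable (fun x => inner ℝ (u i x) (u j x)) μ := fun i j => by
    have h := memLp_one_iff_integrable.1 ((hu j).norm.mul (hu i).norm (r := 1))
    refine h.mono ((hu i).1.inner (hu j).1) (Filter.Eventually.of_forall fun x => ?_)
    simpa using norm_inner_le_norm (𝕜 := ℝ) (u i x) (u j x)
  have h1 : ∀ x, ‖∑ i, v i • u i x‖ ^ 2 = ∑ i, ∑ j, v i * (inner ℝ (u i x) (u j x) * v j) := by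
    intro x
    rw [← real_inner_self_eq_norm_sq, sum_inner]
    refine Finset.sum_congr rfl fun i _ => ?_
    rw [inner_sum]
    refine Finset.sum_congr rfl fun j _ => ?_
    rw [real_inner_smul_left, real_inner_smul_right]
    ring
  simp only [h1]
  rw [integral_finsetSum _ fun i _ => integrable_finsetSum _ fun j _ =>
    ((hint i j).mul_const _).const_mul _]
  simp only [dotProduct, Matrix.mulVec, gramMatrix, Finset.mul_sum]
  refine Finset.sum_congr rfl fun i _ => ?_
  rw [integral_finsetSum _ fun j _ => ((hint i j).mul_const _).const_mul _]
  refine Finset.sum_congr rfl fun j _ => ?_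
  rw [integral_const_mul, integral_mul_const]

lemma quadForm_gram_nonneg (hu : ∀ i, MemLp (u i) 2 μ) (v : Fin m → ℝ) :
    0 ≤ dotProduct v ((gramMatrix μ u).mulVec v) := by
  rw [quadForm_gram hu]
  exact integral_nonneg fun x => by positivity

lemma isHermitian_gram (μ : Measure (Euc d)) (u : Fin m → Euc d → Euc d) :
    (gramMatrix μ u).IsHermitian := by
  ext i j
  simp [Matrix.conjTranspose_apply, gramMatrix, real_inner_comm]

/-- A kernel vector of the Gram matrix is a linear relation between the vector fields. -/
lemma sum_smul_ae_eq_zero_of_gram_mulVec_eq_zero (hu : ∀ i, MemLp (u i) 2 μ) {v : Fin m → ℝ}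
    (hv : (gramMatrix μ u).mulVec v = 0) :
    ∀ᵐ x ∂μ, ∑ i, v i • u i x = 0 := by
  have h1 := quadForm_gram hu v
  rw [hv, dotProduct_zero] at h1
  have h2 : MemLp (fun x => ∑ i, v i • u i x) 2 μ :=
    memLp_finsetSum _ fun i _ => (hu i).const_smul (v i)
  have h3 := (integral_eq_zero_iff_of_nonneg (fun x => by positivity)
    (h2.integrable_norm_pow two_ne_zero)).1 h1.symm
  filter_upwards [h3] with x hx
  simpa using hx

end Gram

/-! ### Error of the empirical Gram matrix -/

/-- The law of large numbers in `L¹`, with the rate coming from Chebyshev's second moment bound. -/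
lemma lintegral_abs_empirical_mean_sub_le {S : Type*} [MeasurableSpace S] {P : Measure S}
    [IsProbabilityMeasure P] {n : ℕ} (hn : 1 ≤ n) {W : Fin n → S → ℝ} {a B : ℝ} (hB : 0 ≤ B)
    (hW : ∀ k, MemLp (W k) 2 P) (hind : Pairwise fun k l => IndepFun (W k) (W l) P)
    (hmean : ∀ k, ∫ s, W k s ∂P = a) (hsq : ∀ k, ∫⁻ s, ‖W k s‖ₑ ^ 2 ∂P ≤ ENNReal.ofReal (B ^ 2)) :
    ∫⁻ s, ‖(n : ℝ)⁻¹ * ∑ k, W k s - a‖ₑ ∂P ≤ ENNReal.ofReal (B / √(n : ℝ)) := by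
  have hn0 : (0 : ℝ) < n := by exact_mod_cast hn
  set M : S → ℝ := fun s => (n : ℝ)⁻¹ * ∑ k, W k s with hM
  have hML : MemLp M 2 P := by
    have : MemLp (fun s => ∑ k, W k s) 2 P := memLp_finsetSum _ fun k _ => hW k
    exact this.const_mul _
  have hMean : ∫ s, M s ∂P = a := by
    simp only [hM]
    rw [integral_const_mul, integral_finsetSum _ fun k _ => (hW k).integrable (by norm_num)]
    simp [hmean]
    field_simp
  have hvark : ∀ k, Var[W k; P] ≤ B ^ 2 := by
    intro k
    refine (variance_le_expectation_sq (hW k).1).trans ?_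
    have h1 : ENNReal.ofReal (∫ s, (W k ^ 2) s ∂P) ≤ ENNReal.ofReal (B ^ 2) := by
      refine le_trans (le_of_eq ?_) (hsq k)
      simp only [Pi.pow_apply]
      rw [ofReal_integral_eq_lintegral_ofReal (hW k).integrable_sq
        (Filter.Eventually.of_forall fun s => by simp only [Pi.zero_apply]; positivity)]
      refine lintegral_congr fun s => ?_
      rw [← ofReal_norm, ← ENNReal.ofReal_pow (norm_nonneg _)]
      simp
    exact (ENNReal.ofReal_le_ofReal_iff (by positivity)).1 h1
  have hvar : Var[M; P] ≤ (B / √(n : ℝ)) ^ 2 := by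
    have h1 : Var[M; P] = (n : ℝ)⁻¹ ^ 2 * Var[∑ k, W k; P] := by
      rw [← variance_const_mul]
      congr 1
      funext s
      simp [hM]
    rw [h1, IndepFun.variance_sum (fun k _ => hW k) (fun k _ l _ hkl => hind hkl)]
    have h2 : ∑ k, Var[W k; P] ≤ n * B ^ 2 := by
      refine (Finset.sum_le_sum fun k _ => hvark k).trans ?_
      simp
    calc (n : ℝ)⁻¹ ^ 2 * ∑ k, Var[W k; P] ≤ (n : ℝ)⁻¹ ^ 2 * (n * B ^ 2) := by gcongr
      _ = (B / √(n : ℝ)) ^ 2 := by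
        rw [div_pow, Real.sq_sqrt hn0.le]
        field_simp
  have hev : ∫⁻ s, ‖M s - a‖ₑ ^ 2 ∂P ≤ ENNReal.ofReal (B / √(n : ℝ)) ^ 2 := by
    rw [← ENNReal.ofReal_pow (by positivity), ← hMean]
    refine le_trans (le_of_eq ?_) (ENNReal.ofReal_le_ofReal hvar)
    rw [hML.ofReal_variance_eq]
    rfl
  have hcs := sq_lintegral_mul_le P (aemeasurable_const (b := (1 : ℝ≥0∞)))
    (hML.1.aemeasurable.sub_const a).enorm
  simp only [one_mul, one_pow, lintegral_const, measure_univ, mul_one] at hcs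
  exact (ENNReal.pow_le_pow_left_iff two_ne_zero).1 (hcs.trans hev)

/-- Cauchy–Schwarz bound for the change of `⟪u, v⟫` under perturbations of `u` and `v` which are
small in mean square. -/
lemma lintegral_inner_sub_inner_le {γ : Type*} [MeasurableSpace γ] {ρ : Measure γ} {d : ℕ}
    {U V u v : γ → Euc d} (hU : Measurable U) (hV : Measurable V) (hu : Measurable u)
    (hv : Measurable v) {t B : ℝ} (ht : 0 ≤ t) (hB : 0 ≤ B)
    (hUu : ∫⁻ z, ‖U z - u z‖ₑ ^ 2 ∂ρ ≤ ENNReal.ofReal t)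
    (hVv : ∫⁻ z, ‖V z - v z‖ₑ ^ 2 ∂ρ ≤ ENNReal.ofReal t)
    (huB : ∫⁻ z, ‖u z‖ₑ ^ 2 ∂ρ ≤ ENNReal.ofReal B)
    (hvB : ∫⁻ z, ‖v z‖ₑ ^ 2 ∂ρ ≤ ENNReal.ofReal B) :
    ∫⁻ z, ‖inner ℝ (U z) (V z) - inner ℝ (u z) (v z)‖ₑ ∂ρ
      ≤ ENNReal.ofReal (2 * √(t * B) + t) := by
  have cs : ∀ {f g : γ → ℝ≥0∞}, AEMeasurable f ρ → AEMeasurable g ρ → ∀ {a b : ℝ}, 0 ≤ a →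
      0 ≤ b → ∫⁻ z, f z ^ 2 ∂ρ ≤ ENNReal.ofReal a → ∫⁻ z, g z ^ 2 ∂ρ ≤ ENNReal.ofReal b →
      ∫⁻ z, f z * g z ∂ρ ≤ ENNReal.ofReal (√(a * b)) := by
    intro f g hf hg a b ha hb h1 h2
    have h3 := (sq_lintegral_mul_le ρ hf hg).trans (mul_le_mul' h1 h2)
    rw [← ENNReal.ofReal_mul ha, ← Real.sq_sqrt (mul_nonneg ha hb),
      ENNReal.ofReal_pow (Real.sqrt_nonneg _)] at h3
    exact (ENNReal.pow_le_pow_left_iff two_ne_zero).1 h3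
  have mUu : Measurable fun z => ‖U z - u z‖ₑ := (hU.sub hu).enorm
  have mVv : Measurable fun z => ‖V z - v z‖ₑ := (hV.sub hv).enorm
  have mu : Measurable fun z => ‖u z‖ₑ := hu.enorm
  have mv : Measurable fun z => ‖v z‖ₑ := hv.enorm
  have hi : ∀ x y : Euc d, ‖inner ℝ x y‖ₑ ≤ ‖x‖ₑ * ‖y‖ₑ := by
    intro x y
    rw [← ofReal_norm, ← ofReal_norm, ← ofReal_norm, ← ENNReal.ofReal_mul (norm_nonneg _)]
    exact ENNReal.ofReal_le_ofReal (norm_inner_le_norm x y)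
  have hpt : ∀ z, ‖inner ℝ (U z) (V z) - inner ℝ (u z) (v z)‖ₑ
      ≤ ‖U z - u z‖ₑ * ‖v z‖ₑ + ‖u z‖ₑ * ‖V z - v z‖ₑ + ‖U z - u z‖ₑ * ‖V z - v z‖ₑ := by
    intro z
    have h1 : inner ℝ (U z) (V z) - inner ℝ (u z) (v z)
        = inner ℝ (U z - u z) (v z) + inner ℝ (u z) (V z - v z)
          + inner ℝ (U z - u z) (V z - v z) := by
      simp only [inner_sub_left, inner_sub_right]
      ring
    rw [h1]
    exact (enorm_add_le _ _).trans (add_le_add ((enorm_add_le _ _).trans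
      (add_le_add (hi _ _) (hi _ _))) (hi _ _))
  calc ∫⁻ z, ‖inner ℝ (U z) (V z) - inner ℝ (u z) (v z)‖ₑ ∂ρ
      ≤ ∫⁻ z, (‖U z - u z‖ₑ * ‖v z‖ₑ + ‖u z‖ₑ * ‖V z - v z‖ₑ
          + ‖U z - u z‖ₑ * ‖V z - v z‖ₑ) ∂ρ := lintegral_mono hpt
    _ = ∫⁻ z, ‖U z - u z‖ₑ * ‖v z‖ₑ ∂ρ + ∫⁻ z, ‖u z‖ₑ * ‖V z - v z‖ₑ ∂ρ
          + ∫⁻ z, ‖U z - u z‖ₑ * ‖V z - v z‖ₑ ∂ρ := by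
        rw [← lintegral_add_right _ (by fun_prop), ← lintegral_add_right _ (by fun_prop)]
    _ ≤ ENNReal.ofReal (√(t * B)) + ENNReal.ofReal (√(B * t)) + ENNReal.ofReal (√(t * t)) := by
        gcongr
        · exact cs mUu.aemeasurable mv.aemeasurable ht hB hUu hvB
        · exact cs mu.aemeasurable mVv.aemeasurable hB ht huB hVv
        · exact cs mUu.aemeasurable mVv.aemeasurable ht ht hUu hVv
    _ = ENNReal.ofReal (2 * √(t * B) + t) := by
        rw [← ENNReal.ofReal_add (by positivity) (by positivity),
          ← ENNReal.ofReal_add (by positivity) (by positivity), mul_comm B t,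
          Real.sqrt_mul_self ht]
        congr 1
        ring

/-- The expected error of an empirical Gram entry, where the estimated fields `U (Z s)`, `V (Z s)`
are built from data `Z` independent of each of the points `X k` at which they are evaluated. -/
lemma lintegral_empirical_inner_sub_le {S β : Type*} [MeasurableSpace S] [MeasurableSpace β]
    {P : Measure S} [IsProbabilityMeasure P] {d n : ℕ} (hn : 1 ≤ n) {μ : Measure (Euc d)}
    [IsProbabilityMeasure μ] {X : Fin n → S → Euc d} {Z : S → β}
    (hX : ∀ k, HasLaw (X k) μ P) (hZ : AEMeasurable Z P)
    (hZX : ∀ k, IndepFun Z (X k) P) (hXX : Pairwise fun k l => IndepFun (X k) (X l) P)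
    {U V : β × Euc d → Euc d} (hU : Measurable U) (hV : Measurable V)
    {u v : Euc d → Euc d} (hu : Measurable u) (hv : Measurable v)
    {t B : ℝ} (ht : 0 ≤ t) (hB : 0 ≤ B)
    (hUu : ∫⁻ s, ∫⁻ x, ‖U (Z s, x) - u x‖ₑ ^ 2 ∂μ ∂P ≤ ENNReal.ofReal t)
    (hVv : ∫⁻ s, ∫⁻ x, ‖V (Z s, x) - v x‖ₑ ^ 2 ∂μ ∂P ≤ ENNReal.ofReal t)
    (huB : ∫⁻ x, ‖u x‖ₑ ^ 4 ∂μ ≤ ENNReal.ofReal (B ^ 2))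
    (hvB : ∫⁻ x, ‖v x‖ₑ ^ 4 ∂μ ≤ ENNReal.ofReal (B ^ 2)) :
    ∫⁻ s, ‖(∫ x, inner ℝ (u x) (v x) ∂μ)
        - (n : ℝ)⁻¹ * ∑ k, inner ℝ (U (Z s, X k s)) (V (Z s, X k s))‖ₑ ∂P
      ≤ ENNReal.ofReal (2 * √(t * B) + t + B / √(n : ℝ)) := by
  have hn0 : (0 : ℝ) < n := by exact_mod_cast hn
  have hprobZ : IsProbabilityMeasure (P.map Z) := Measure.isProbabilityMeasure_map hZ
  have huB2 := lintegral_sq_le_of_pow_four_le hu.enorm.aemeasurable hB huB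
  have hvB2 := lintegral_sq_le_of_pow_four_le hv.enorm.aemeasurable hB hvB
  -- the error made by replacing the estimated fields by the true ones, at one sample point
  have hdiff : ∀ k, ∫⁻ s, ‖inner ℝ (U (Z s, X k s)) (V (Z s, X k s))
      - inner ℝ (u (X k s)) (v (X k s))‖ₑ ∂P ≤ ENNReal.ofReal (2 * √(t * B) + t) := by
    intro k
    have hlaw : P.map (fun s => (Z s, X k s)) = (P.map Z).prod μ := by
      rw [(indepFun_iff_map_prod_eq_prod_map_map hZ (hX k).aemeasurable).1 (hZX k),
        (hX k).map_eq]
    have hpair : AEMeasurable (fun s => (Z s, X k s)) P := hZ.prodMk (hX k).aemeasurable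
    have hrew : ∀ {F : β × Euc d → ℝ≥0∞}, Measurable F →
        ∫⁻ z, F z ∂((P.map Z).prod μ) = ∫⁻ s, ∫⁻ x, F (Z s, x) ∂μ ∂P := by
      intro F hF
      rw [lintegral_prod _ hF.aemeasurable, lintegral_map' hF.lintegral_prod_right'.aemeasurable hZ]
    have hsnd : ∀ {F : Euc d → ℝ≥0∞}, Measurable F →
        ∫⁻ z, F z.2 ∂((P.map Z).prod μ) = ∫⁻ x, F x ∂μ := by
      intro F hF
      rw [hrew (F := fun z => F z.2) (hF.comp measurable_snd)]
      simp
    have hu' : Measurable fun z : β × Euc d => u z.2 := hu.comp measurable_snd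
    have hv' : Measurable fun z : β × Euc d => v z.2 := hv.comp measurable_snd
    have hmeas : Measurable fun z : β × Euc d =>
        ‖inner ℝ (U z) (V z) - inner ℝ (u z.2) (v z.2)‖ₑ := by fun_prop
    rw [← lintegral_map' (f := fun z : β × Euc d =>
        ‖inner ℝ (U z) (V z) - inner ℝ (u z.2) (v z.2)‖ₑ) hmeas.aemeasurable hpair, hlaw]
    refine lintegral_inner_sub_inner_le hU hV hu' hv' ht hB ?_ ?_ ?_ ?_
    · rw [hrew (F := fun z => ‖U z - u z.2‖ₑ ^ 2) (by fun_prop)]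
      exact hUu
    · rw [hrew (F := fun z => ‖V z - v z.2‖ₑ ^ 2) (by fun_prop)]
      exact hVv
    · rw [hsnd (F := fun x => ‖u x‖ₑ ^ 2) (by fun_prop)]
      exact huB2
    · rw [hsnd (F := fun x => ‖v x‖ₑ ^ 2) (by fun_prop)]
      exact hvB2
  -- fluctuation of the empirical mean for the true fields
  set W : Fin n → S → ℝ := fun k s => inner ℝ (u (X k s)) (v (X k s)) with hWdef
  have hφ : Measurable fun x : Euc d => inner ℝ (u x) (v x) := by fun_prop
  have hφ2 : ∫⁻ x, ‖inner ℝ (u x) (v x)‖ₑ ^ 2 ∂μ ≤ ENNReal.ofReal (B ^ 2) := by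
    have h1 := sq_lintegral_mul_le μ (hu.enorm.pow_const 2).aemeasurable
      (hv.enorm.pow_const 2).aemeasurable
    simp only [← pow_mul] at h1
    have h2 : (∫⁻ x, ‖u x‖ₑ ^ 2 * ‖v x‖ₑ ^ 2 ∂μ) ^ 2 ≤ ENNReal.ofReal (B ^ 2) ^ 2 :=
      h1.trans ((mul_le_mul' huB hvB).trans_eq (sq _).symm)
    refine le_trans (lintegral_mono fun x => ?_) ((ENNReal.pow_le_pow_left_iff two_ne_zero).1 h2)
    rw [← mul_pow]
    gcongr
    rw [← ofReal_norm, ← ofReal_norm, ← ofReal_norm, ← ENNReal.ofReal_mul (norm_nonneg _)]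
    exact ENNReal.ofReal_le_ofReal (norm_inner_le_norm _ _)
  have hWsq : ∀ k, ∫⁻ s, ‖W k s‖ₑ ^ 2 ∂P ≤ ENNReal.ofReal (B ^ 2) := by
    intro k
    refine le_trans (le_of_eq ?_) hφ2
    rw [← (hX k).map_eq, lintegral_map' (by fun_prop) (hX k).aemeasurable]
  have hWL : ∀ k, MemLp (W k) 2 P := fun k => memLp_two_of_lintegral_sq_lt_top
    (hφ.comp_aemeasurable (hX k).aemeasurable).aestronglyMeasurable
    ((hWsq k).trans_lt ENNReal.ofReal_lt_top)
  have hWmean : ∀ k, ∫ s, W k s ∂P = ∫ x, inner ℝ (u x) (v x) ∂μ := by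
    intro k
    rw [← (hX k).map_eq, integral_map (hX k).aemeasurable hφ.aestronglyMeasurable]
  have hfluct := lintegral_abs_empirical_mean_sub_le hn hB hWL
    (fun k l hkl => (hXX hkl).comp hφ hφ) hWmean hWsq
  have hpt : ∀ s, ‖(∫ x, inner ℝ (u x) (v x) ∂μ)
        - (n : ℝ)⁻¹ * ∑ k, inner ℝ (U (Z s, X k s)) (V (Z s, X k s))‖ₑ
      ≤ ENNReal.ofReal (n : ℝ)⁻¹ * ∑ k, ‖inner ℝ (U (Z s, X k s)) (V (Z s, X k s)) - W k s‖ₑ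
        + ‖(n : ℝ)⁻¹ * ∑ k, W k s - ∫ x, inner ℝ (u x) (v x) ∂μ‖ₑ := by
    intro s
    have h1 : (∫ x, inner ℝ (u x) (v x) ∂μ)
        - (n : ℝ)⁻¹ * ∑ k, inner ℝ (U (Z s, X k s)) (V (Z s, X k s))
        = -((n : ℝ)⁻¹ * ∑ k, (inner ℝ (U (Z s, X k s)) (V (Z s, X k s)) - W k s)
          + ((n : ℝ)⁻¹ * ∑ k, W k s - ∫ x, inner ℝ (u x) (v x) ∂μ)) := by
      rw [Finset.sum_sub_distrib]
      ring
    rw [h1, enorm_neg]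
    refine (enorm_add_le _ _).trans ?_
    gcongr
    rw [enorm_mul, Real.enorm_of_nonneg (by positivity)]
    gcongr
    exact enorm_sum_le _ _
  have hZXm : ∀ k, AEMeasurable (fun s => (Z s, X k s)) P := fun k => hZ.prodMk (hX k).aemeasurable
  have hterm : ∀ k, AEMeasurable
      (fun s => ‖inner ℝ (U (Z s, X k s)) (V (Z s, X k s)) - W k s‖ₑ) P := by
    intro k
    exact (((hU.comp_aemeasurable (hZXm k)).inner (hV.comp_aemeasurable (hZXm k))).sub
      (hWL k).1.aemeasurable).enorm
  calc ∫⁻ s, ‖(∫ x, inner ℝ (u x) (v x) ∂μ)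
        - (n : ℝ)⁻¹ * ∑ k, inner ℝ (U (Z s, X k s)) (V (Z s, X k s))‖ₑ ∂P
      ≤ ∫⁻ s, (ENNReal.ofReal (n : ℝ)⁻¹
            * ∑ k, ‖inner ℝ (U (Z s, X k s)) (V (Z s, X k s)) - W k s‖ₑ
          + ‖(n : ℝ)⁻¹ * ∑ k, W k s - ∫ x, inner ℝ (u x) (v x) ∂μ‖ₑ) ∂P := lintegral_mono hpt
    _ = ENNReal.ofReal (n : ℝ)⁻¹
            * ∑ k, ∫⁻ s, ‖inner ℝ (U (Z s, X k s)) (V (Z s, X k s)) - W k s‖ₑ ∂P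
          + ∫⁻ s, ‖(n : ℝ)⁻¹ * ∑ k, W k s - ∫ x, inner ℝ (u x) (v x) ∂μ‖ₑ ∂P := by
        rw [lintegral_add_left' ((Finset.aemeasurable_fun_sum _ fun k _ => hterm k).const_mul _),
          lintegral_const_mul' _ _ ENNReal.ofReal_ne_top,
          lintegral_finsetSum' _ fun k _ => hterm k]
    _ ≤ ENNReal.ofReal (n : ℝ)⁻¹ * ∑ _k : Fin n, ENNReal.ofReal (2 * √(t * B) + t)
          + ENNReal.ofReal (B / √(n : ℝ)) := by
        gcongr with k
        exact hdiff k
    _ = ENNReal.ofReal (2 * √(t * B) + t + B / √(n : ℝ)) := by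
        rw [← ENNReal.ofReal_sum_of_nonneg fun i _ => by positivity,
          ← ENNReal.ofReal_mul (by positivity),
          ← ENNReal.ofReal_add (by positivity) (by positivity)]
        congr 1
        simp
        field_simp

/-! ### Recovery of the coefficients from the empirical Gram matrix -/

/-- Recovery of the coefficients of the linear relation between the fields `u i` from estimates
`U i (Z s)` of these fields and a second, independent sample. -/
lemma integral_sq_dist_minimizer_le {S β : Type*} [MeasurableSpace S] [MeasurableSpace β]
    {P : Measure S} [IsProbabilityMeasure P] {d m n : ℕ} (hn : 1 ≤ n) {μ : Measure (Euc d)}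
    [IsProbabilityMeasure μ] {X : Fin n → S → Euc d} {Z : S → β}
    (hX : ∀ k, HasLaw (X k) μ P) (hZ : AEMeasurable Z P)
    (hZX : ∀ k, IndepFun Z (X k) P) (hXX : Pairwise fun k l => IndepFun (X k) (X l) P)
    {U : Fin m → β × Euc d → Euc d} (hU : ∀ i, Measurable (U i))
    {u : Fin m → Euc d → Euc d} (hu : ∀ i, Measurable (u i))
    {t B : ℝ} (ht : 0 ≤ t) (hB : 0 ≤ B)
    (hUu : ∀ i, ∫⁻ s, ∫⁻ x, ‖U i (Z s, x) - u i x‖ₑ ^ 2 ∂μ ∂P ≤ ENNReal.ofReal t)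
    (huB : ∀ i, ∫⁻ x, ‖u i x‖ₑ ^ 4 ∂μ ≤ ENNReal.ofReal (B ^ 2))
    {lam : Fin m → ℝ} {α : ℝ} (hlam : SimpleZeroEigenvalue (gramMatrix μ u) lam)
    (hα : IsSmallestNonzeroEigenvalue (gramMatrix μ u) α)
    {lamHat : S → Fin m → ℝ} (hlamHat : Measurable lamHat)
    (hmin : ∀ᵐ s ∂P, IsSimplexMinimizer (fun i j =>
      (n : ℝ)⁻¹ * ∑ k, inner ℝ (U i (Z s, X k s)) (U j (Z s, X k s))) (lamHat s)) :
    0 < α ∧ ∫ s, ∑ i, (lamHat s i - lam i) ^ 2 ∂P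
      ≤ 2 * (m + 1) / α * (m ^ 2 * (2 * √(t * B) + t + B / √(n : ℝ))) := by
  have hL2 : ∀ i, MemLp (u i) 2 μ := fun i => memLp_two_of_lintegral_sq_lt_top
    (hu i).aestronglyMeasurable ((lintegral_sq_le_of_pow_four_le (hu i).enorm.aemeasurable hB
      (huB i)).trans_lt ENNReal.ofReal_lt_top)
  have hα0 := smallest_eigenvalue_pos (quadForm_gram_nonneg hL2) hα
  refine ⟨hα0, ?_⟩
  set c : ℝ := 2 * (m + 1) / α with hc
  set b : ℝ := 2 * √(t * B) + t + B / √(n : ℝ) with hb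
  have hc0 : 0 ≤ c := by positivity
  have hb0 : 0 ≤ b := by positivity
  set D : Fin m → Fin m → S → ℝ := fun i j s => gramMatrix μ u i j
    - (n : ℝ)⁻¹ * ∑ k, inner ℝ (U i (Z s, X k s)) (U j (Z s, X k s)) with hD
  have hDm : ∀ i j, AEMeasurable (D i j) P := by
    intro i j
    have hZXm : ∀ k, AEMeasurable (fun s => (Z s, X k s)) P :=
      fun k => hZ.prodMk (hX k).aemeasurable
    exact ((Finset.aemeasurable_fun_sum _ fun k _ =>
      ((hU i).comp_aemeasurable (hZXm k)).inner ((hU j).comp_aemeasurable (hZXm k))).const_mul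
        _).const_sub _
  have hDb : ∀ i j, ∫⁻ s, ‖D i j s‖ₑ ∂P ≤ ENNReal.ofReal b := fun i j =>
    lintegral_empirical_inner_sub_le hn hX hZ hZX hXX (hU i) (hU j) (hu i) (hu j) ht hB
      (hUu i) (hUu j) (huB i) (huB j)
  have hpt : ∀ᵐ s ∂P, ENNReal.ofReal (∑ i, (lamHat s i - lam i) ^ 2)
      ≤ ENNReal.ofReal c * ∑ i, ∑ j, ‖D i j s‖ₑ := by
    filter_upwards [hmin] with s hs
    have h1 := sq_dist_minimizer_le (isHermitian_gram μ u) (quadForm_gram_nonneg hL2) hlam hα hs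
    refine (ENNReal.ofReal_le_ofReal h1).trans_eq ?_
    rw [ENNReal.ofReal_mul hc0, ENNReal.ofReal_sum_of_nonneg fun i _ =>
      Finset.sum_nonneg fun j _ => abs_nonneg _]
    congr 1
    refine Finset.sum_congr rfl fun i _ => ?_
    rw [ENNReal.ofReal_sum_of_nonneg fun j _ => abs_nonneg _]
    exact Finset.sum_congr rfl fun j _ => by rw [← Real.norm_eq_abs, ofReal_norm]
  have hlint : ∫⁻ s, ENNReal.ofReal (∑ i, (lamHat s i - lam i) ^ 2) ∂P
      ≤ ENNReal.ofReal (c * (m ^ 2 * b)) := by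
    calc ∫⁻ s, ENNReal.ofReal (∑ i, (lamHat s i - lam i) ^ 2) ∂P
        ≤ ∫⁻ s, ENNReal.ofReal c * ∑ i, ∑ j, ‖D i j s‖ₑ ∂P := lintegral_mono_ae hpt
      _ = ENNReal.ofReal c * ∑ i, ∑ j, ∫⁻ s, ‖D i j s‖ₑ ∂P := by
        rw [lintegral_const_mul' _ _ ENNReal.ofReal_ne_top, lintegral_finsetSum' _ fun i _ =>
          Finset.aemeasurable_fun_sum _ fun j _ => (hDm i j).enorm]
        congr 1
        exact Finset.sum_congr rfl fun i _ => lintegral_finsetSum' _ fun j _ => (hDm i j).enorm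
      _ ≤ ENNReal.ofReal c * ∑ _i : Fin m, ∑ _j : Fin m, ENNReal.ofReal b := by
        gcongr with i _ j _
        exact hDb i j
      _ = ENNReal.ofReal (c * (m ^ 2 * b)) := by
        rw [← ENNReal.ofReal_sum_of_nonneg fun _ _ => hb0,
          ← ENNReal.ofReal_sum_of_nonneg fun _ _ => Finset.sum_nonneg fun _ _ => hb0,
          ← ENNReal.ofReal_mul hc0]
        congr 2
        simp
        ring
  rw [integral_eq_lintegral_of_nonneg_ae
    (Filter.Eventually.of_forall fun s => Finset.sum_nonneg fun i _ => sq_nonneg _)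
    (by fun_prop)]
  exact ENNReal.toReal_le_of_le_ofReal (by positivity) hlint

/-- Collecting constants, for fields with fourth moment at most `(6K)²` estimated with mean squared
error at most `4θ`. -/
lemma error_bound_le {m n : ℕ} (hn : 1 ≤ n) (hm : 1 ≤ m) {α K θ : ℝ} (hα : 0 < α) (hK : 0 ≤ K)
    (hθ : 0 ≤ θ) :
    2 * (m + 1) / α * (m ^ 2 * (2 * √(4 * θ * (6 * K)) + 4 * θ + 6 * K / √(n : ℝ)))
      ≤ 80 * m ^ 3 * max 1 K / α * max (1 / √(n : ℝ)) (√(θ + θ ^ 2)) := by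
  have hm' : (1 : ℝ) ≤ m := by exact_mod_cast hm
  set L := max 1 K with hL
  set M := max (1 / √(n : ℝ)) (√(θ + θ ^ 2)) with hM
  have hL1 : 1 ≤ L := le_max_left _ _
  have hKL : K ≤ L := le_max_right _ _
  have hM1 : 1 / √(n : ℝ) ≤ M := le_max_left _ _
  have hM2 : √(θ + θ ^ 2) ≤ M := le_max_right _ _
  have hM0 : 0 ≤ M := le_trans (by positivity) hM1
  have hML : M ≤ M * L := le_mul_of_one_le_right hM0 hL1
  have hsum : θ + θ ^ 2 ≤ M ^ 2 := by
    rw [← Real.sq_sqrt (show 0 ≤ θ + θ ^ 2 by positivity)]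
    gcongr
  have hθM : θ ≤ M := abs_le_of_sq_le_sq' (by linarith) hM0 |>.2
  have h1 : √(4 * θ * (6 * K)) ≤ 5 * (M * L) := by
    refine Real.sqrt_le_iff.2 ⟨by positivity, ?_⟩
    have h2 : θ * K ≤ M ^ 2 * L ^ 2 := by
      refine mul_le_mul (by nlinarith [sq_nonneg θ]) (by nlinarith) hK (by positivity)
    nlinarith [mul_nonneg hθ hK]
  have h3 : 6 * K / √(n : ℝ) ≤ 6 * (M * L) := by
    calc 6 * K / √(n : ℝ) = 6 * (1 / √(n : ℝ) * K) := by ring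
      _ ≤ 6 * (M * L) := by gcongr
  have h4 : 2 * √(4 * θ * (6 * K)) + 4 * θ + 6 * K / √(n : ℝ) ≤ 20 * (M * L) := by linarith
  calc 2 * (m + 1) / α * (m ^ 2 * (2 * √(4 * θ * (6 * K)) + 4 * θ + 6 * K / √(n : ℝ)))
      ≤ 2 * (m + m) / α * (m ^ 2 * (20 * (M * L))) := by gcongr
    _ = 80 * m ^ 3 * L / α * M := by ring

/-! ### The samples -/

section Sample

variable {d m : ℕ} {S : Type*} [MeasurableSpace S] {P : Measure S} {μ : Measure (Euc d)}
  {ν : Fin m → Measure (Euc d)} {X : ℕ → S → Euc d} {Y : Fin m → ℕ → S → Euc d}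

lemma IsSample.aemeasurable_firstBatch (h : IsSample P μ ν X Y) (n : ℕ) :
    AEMeasurable (fun s => (firstBatch n (X · s), fun j => firstBatch n (Y j · s))) P :=
  AEMeasurable.prodMk
    (aemeasurable_pi_lambda _ fun k => (h.law_X k).aemeasurable)
    (aemeasurable_pi_lambda _ fun j => aemeasurable_pi_lambda _ fun k =>
      (h.law_Y j k).aemeasurable)

lemma IsSample.indepFun_firstBatch (h : IsSample P μ ν X Y) (n k : ℕ) :
    IndepFun (fun s => (firstBatch n (X · s), fun j => firstBatch n (Y j · s))) (X (n + k)) P := by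
  classical
  let A : Finset (ℕ ⊕ Fin m × ℕ) := (Finset.range n).disjSum (Finset.univ ×ˢ Finset.range n)
  let C : Finset (ℕ ⊕ Fin m × ℕ) := {Sum.inl (n + k)}
  have hAC : Disjoint A C := by
    simp [A, C]
  have hm : ∀ i, AEMeasurable (Sum.elim X (fun p : Fin m × ℕ => Y p.1 p.2) i) P := by
    rintro (i | ⟨j, i⟩)
    · exact (h.law_X i).aemeasurable
    · exact (h.law_Y j i).aemeasurable
  have hI := h.indep.indepFun_finset₀ A C hAC hm
  have hφ : Measurable fun z : A → Euc d =>
      ((fun i : Fin n => z ⟨Sum.inl i, by simp [A]⟩ : Fin n → Euc d),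
        fun (j : Fin m) (i : Fin n) => z ⟨Sum.inr (j, i), by simp [A]⟩) := by
    fun_prop
  have hψ : Measurable fun z : C → Euc d => z ⟨Sum.inl (n + k), by simp [C]⟩ := by fun_prop
  exact hI.comp hφ hψ

lemma IsSample.pairwise_indepFun_secondBatch (h : IsSample P μ ν X Y) (n : ℕ) :
    Pairwise fun k l : Fin n => IndepFun (X (n + k)) (X (n + l)) P := by
  intro k l hkl
  have hne : (Sum.inl (n + k) : ℕ ⊕ Fin m × ℕ) ≠ Sum.inl (n + l) := by
    simpa [Fin.val_inj] using hkl
  exact h.indep.indepFun hne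

end Sample

/-! ### Moment and error bounds for the two choices of the reference map -/

lemma lintegral_sub_pow_four_le {d : ℕ} {μ : Measure (Euc d)} {T R : Euc d → Euc d}
    (hT : Measurable T) {K : ℝ}
    (hTK : ∫⁻ x, ‖T x‖ₑ ^ 4 ∂μ ≤ ENNReal.ofReal (2 * K ^ 2))
    (hRK : ∫⁻ x, ‖R x‖ₑ ^ 4 ∂μ ≤ ENNReal.ofReal (2 * K ^ 2)) :
    ∫⁻ x, ‖T x - R x‖ₑ ^ 4 ∂μ ≤ ENNReal.ofReal ((6 * K) ^ 2) := by
  have h1 : ∀ x, ‖T x - R x‖ₑ ^ 4 ≤ 8 * (‖T x‖ₑ ^ 4 + ‖R x‖ₑ ^ 4) := by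
    intro x
    have h2 : ‖T x - R x‖ ^ 4 ≤ 8 * (‖T x‖ ^ 4 + ‖R x‖ ^ 4) := by
      refine (pow_le_pow_left₀ (norm_nonneg _) (norm_sub_le _ _) 4).trans ?_
      have := add_pow_le (norm_nonneg (T x)) (norm_nonneg (R x)) 4
      norm_num at this
      exact this
    have h3 := ENNReal.ofReal_le_ofReal h2
    rw [ENNReal.ofReal_mul (by norm_num), ENNReal.ofReal_add (by positivity) (by positivity),
      ENNReal.ofReal_pow (norm_nonneg _), ENNReal.ofReal_pow (norm_nonneg _),
      ENNReal.ofReal_pow (norm_nonneg _), ofReal_norm, ofReal_norm, ofReal_norm] at h3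
    simpa using h3
  calc ∫⁻ x, ‖T x - R x‖ₑ ^ 4 ∂μ ≤ ∫⁻ x, 8 * (‖T x‖ₑ ^ 4 + ‖R x‖ₑ ^ 4) ∂μ := lintegral_mono h1
    _ = 8 * (∫⁻ x, ‖T x‖ₑ ^ 4 ∂μ + ∫⁻ x, ‖R x‖ₑ ^ 4 ∂μ) := by
      rw [lintegral_const_mul' _ _ (by norm_num), lintegral_add_left (hT.enorm.pow_const 4)]
    _ ≤ 8 * (ENNReal.ofReal (2 * K ^ 2) + ENNReal.ofReal (2 * K ^ 2)) := by gcongr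
    _ = ENNReal.ofReal (8 * (2 * K ^ 2 + 2 * K ^ 2)) := by
      rw [← ENNReal.ofReal_add (by positivity) (by positivity), ENNReal.ofReal_mul (by norm_num)]
      simp
    _ ≤ ENNReal.ofReal ((6 * K) ^ 2) := ENNReal.ofReal_le_ofReal (by nlinarith [sq_nonneg K])

/-- If the identity is `μ`-a.e. a convex combination of maps with bounded fourth moments, then `μ`
has bounded fourth moment. -/
lemma lintegral_norm_pow_four_le_of_convex_combination {d m : ℕ} {μ : Measure (Euc d)}
    {T : Fin m → Euc d → Euc d} (hT : ∀ i, Measurable (T i)) {C : ℝ≥0∞}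
    (hTC : ∀ i, ∫⁻ x, ‖T i x‖ₑ ^ 4 ∂μ ≤ C) {lam : Fin m → ℝ}
    (hlam : lam ∈ stdSimplex ℝ (Fin m)) (hx : ∀ᵐ x ∂μ, x = ∑ i, lam i • T i x) :
    ∫⁻ x, ‖x‖ₑ ^ 4 ∂μ ≤ C := by
  have hpt : ∀ᵐ x ∂μ, ‖x‖ₑ ^ 4 ≤ ∑ i, ENNReal.ofReal (lam i) * ‖T i x‖ₑ ^ 4 := by
    filter_upwards [hx] with x hx
    have h1 : ‖x‖ ≤ ∑ i, lam i * ‖T i x‖ := by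
      conv_lhs => rw [hx]
      refine (norm_sum_le _ _).trans_eq (Finset.sum_congr rfl fun i _ => ?_)
      rw [norm_smul, Real.norm_of_nonneg (hlam.1 i)]
    have h2 : ‖x‖ ^ 4 ≤ ∑ i, lam i * ‖T i x‖ ^ 4 :=
      (pow_le_pow_left₀ (norm_nonneg _) h1 4).trans
        (Real.pow_arith_mean_le_arith_mean_pow _ _ _ (fun i _ => hlam.1 i) hlam.2
          (fun i _ => norm_nonneg _) 4)
    have h3 := ENNReal.ofReal_le_ofReal h2
    rw [ENNReal.ofReal_pow (norm_nonneg _), ofReal_norm, ENNReal.ofReal_sum_of_nonneg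
      fun i _ => mul_nonneg (hlam.1 i) (by positivity)] at h3
    refine h3.trans_eq (Finset.sum_congr rfl fun i _ => ?_)
    rw [ENNReal.ofReal_mul (hlam.1 i), ENNReal.ofReal_pow (norm_nonneg _), ofReal_norm]
  calc ∫⁻ x, ‖x‖ₑ ^ 4 ∂μ ≤ ∫⁻ x, ∑ i, ENNReal.ofReal (lam i) * ‖T i x‖ₑ ^ 4 ∂μ :=
        lintegral_mono_ae hpt
    _ = ∑ i, ENNReal.ofReal (lam i) * ∫⁻ x, ‖T i x‖ₑ ^ 4 ∂μ := by
        rw [lintegral_finsetSum _ fun i _ => ((hT i).enorm.pow_const 4).const_mul _]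
        exact Finset.sum_congr rfl fun i _ => lintegral_const_mul' _ _ ENNReal.ofReal_ne_top
    _ ≤ ∑ i, ENNReal.ofReal (lam i) * C := by
        gcongr with i
        exact hTC i
    _ = C := by
        rw [← Finset.sum_mul, ← ENNReal.ofReal_sum_of_nonneg fun i _ => hlam.1 i, hlam.2,
          ENNReal.ofReal_one, one_mul]

lemma expectedSqError_eq {d : ℕ} {S : Type*} [MeasurableSpace S] (P : Measure S)
    (μ : Measure (Euc d)) (T : Euc d → Euc d) (That : S → Euc d → Euc d) :
    expectedSqError P μ T That = ∫⁻ s, ∫⁻ x, ‖That s x - T x‖ₑ ^ 2 ∂μ ∂P := by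
  unfold expectedSqError
  refine lintegral_congr fun s => lintegral_congr fun x => ?_
  rw [ENNReal.ofReal_pow (norm_nonneg _), ofReal_norm, enorm_sub_rev]

/-- The difference of two estimated maps has at most four times the mean squared error. -/
lemma lintegral_sub_sub_sq_le {S β : Type*} [MeasurableSpace S] [MeasurableSpace β]
    {P : Measure S} {d : ℕ} {μ : Measure (Euc d)} [SFinite μ] {Z : S → β} (hZ : AEMeasurable Z P)
    {F G : β × Euc d → Euc d} (hF : Measurable F) {T R : Euc d → Euc d}
    (hT : Measurable T) {t : ℝ} (ht : 0 ≤ t)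
    (hFT : ∫⁻ s, ∫⁻ x, ‖F (Z s, x) - T x‖ₑ ^ 2 ∂μ ∂P ≤ ENNReal.ofReal t)
    (hGR : ∫⁻ s, ∫⁻ x, ‖G (Z s, x) - R x‖ₑ ^ 2 ∂μ ∂P ≤ ENNReal.ofReal t) :
    ∫⁻ s, ∫⁻ x, ‖F (Z s, x) - G (Z s, x) - (T x - R x)‖ₑ ^ 2 ∂μ ∂P
      ≤ ENNReal.ofReal (4 * t) := by
  have hpt : ∀ a b : Euc d, ‖a - b‖ₑ ^ 2 ≤ 2 * (‖a‖ₑ ^ 2 + ‖b‖ₑ ^ 2) := by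
    intro a b
    have h2 : ‖a - b‖ ^ 2 ≤ 2 * (‖a‖ ^ 2 + ‖b‖ ^ 2) := by
      nlinarith [norm_sub_le a b, sq_nonneg (‖a‖ - ‖b‖), norm_nonneg (a - b), norm_nonneg a,
        norm_nonneg b]
    have h3 := ENNReal.ofReal_le_ofReal h2
    rw [ENNReal.ofReal_mul (by norm_num), ENNReal.ofReal_add (by positivity) (by positivity),
      ENNReal.ofReal_pow (norm_nonneg _), ENNReal.ofReal_pow (norm_nonneg _),
      ENNReal.ofReal_pow (norm_nonneg _), ofReal_norm, ofReal_norm, ofReal_norm] at h3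
    simpa using h3
  have hmF : Measurable fun z : β × Euc d => ‖F z - T z.2‖ₑ ^ 2 := by fun_prop
  have hin : ∀ s, ∫⁻ x, ‖F (Z s, x) - G (Z s, x) - (T x - R x)‖ₑ ^ 2 ∂μ
      ≤ 2 * (∫⁻ x, ‖F (Z s, x) - T x‖ₑ ^ 2 ∂μ + ∫⁻ x, ‖G (Z s, x) - R x‖ₑ ^ 2 ∂μ) := by
    intro s
    have h1 : Measurable fun x => ‖F (Z s, x) - T x‖ₑ ^ 2 := hmF.comp measurable_prodMk_left
    rw [← lintegral_add_left h1,
      ← lintegral_const_mul' _ _ (by norm_num)]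
    refine lintegral_mono fun x => ?_
    rw [sub_sub_sub_comm]
    exact hpt _ _
  have hmZ : AEMeasurable (fun s => ∫⁻ x, ‖F (Z s, x) - T x‖ₑ ^ 2 ∂μ) P :=
    (hmF.lintegral_prod_right' (ν := μ)).comp_aemeasurable hZ
  calc ∫⁻ s, ∫⁻ x, ‖F (Z s, x) - G (Z s, x) - (T x - R x)‖ₑ ^ 2 ∂μ ∂P
      ≤ ∫⁻ s, 2 * (∫⁻ x, ‖F (Z s, x) - T x‖ₑ ^ 2 ∂μ
          + ∫⁻ x, ‖G (Z s, x) - R x‖ₑ ^ 2 ∂μ) ∂P := lintegral_mono hin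
    _ = 2 * (∫⁻ s, ∫⁻ x, ‖F (Z s, x) - T x‖ₑ ^ 2 ∂μ ∂P
          + ∫⁻ s, ∫⁻ x, ‖G (Z s, x) - R x‖ₑ ^ 2 ∂μ ∂P) := by
        rw [lintegral_const_mul' _ _ (by norm_num), lintegral_add_left' hmZ]
    _ ≤ 2 * (ENNReal.ofReal t + ENNReal.ofReal t) := by gcongr
    _ = ENNReal.ofReal (4 * t) := by
        rw [← ENNReal.ofReal_add ht ht, show (4 : ℝ) * t = 2 * (t + t) by ring,
          ENNReal.ofReal_mul (by norm_num)]
        simp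

/-! ### The two functionals -/

/-- The common part of both cases: recovery for vector fields `u j` with fourth moment at most
`(6K)²` that are estimated, with mean squared error at most `4θ`, from the first batch of samples. -/
lemma IsSample.integral_sq_dist_le {d m : ℕ} {S : Type*} [MeasurableSpace S] {P : Measure S}
    [IsProbabilityMeasure P] {μ : Measure (Euc d)} [IsProbabilityMeasure μ]
    {ν : Fin m → Measure (Euc d)} {X : ℕ → S → Euc d} {Y : Fin m → ℕ → S → Euc d}
    (h : IsSample P μ ν X Y) {n : ℕ} (hn : 1 ≤ n)
    {U : Fin m → ((Fin n → Euc d) × (Fin m → Fin n → Euc d)) × Euc d → Euc d}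
    (hU : ∀ i, Measurable (U i)) {u : Fin m → Euc d → Euc d} (hu : ∀ i, Measurable (u i))
    {K θ : ℝ} (hK : 0 ≤ K) (hθ : 0 ≤ θ)
    (hUu : ∀ i, ∫⁻ s, ∫⁻ x, ‖U i ((firstBatch n (X · s), fun j => firstBatch n (Y j · s)), x)
      - u i x‖ₑ ^ 2 ∂μ ∂P ≤ ENNReal.ofReal (4 * θ))
    (huB : ∀ i, ∫⁻ x, ‖u i x‖ₑ ^ 4 ∂μ ≤ ENNReal.ofReal ((6 * K) ^ 2))
    {lam : Fin m → ℝ} {α : ℝ} (hlam : SimpleZeroEigenvalue (gramMatrix μ u) lam)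
    (hα : IsSmallestNonzeroEigenvalue (gramMatrix μ u) α)
    {lamHat : S → Fin m → ℝ} (hlamHat : Measurable lamHat)
    (hmin : ∀ᵐ s ∂P, IsSimplexMinimizer (fun i j => (n : ℝ)⁻¹ * ∑ k : Fin n, inner ℝ
      (U i ((firstBatch n (X · s), fun j => firstBatch n (Y j · s)), X (n + k) s))
      (U j ((firstBatch n (X · s), fun j => firstBatch n (Y j · s)), X (n + k) s))) (lamHat s)) :
    ∫ s, ∑ i, (lamHat s i - lam i) ^ 2 ∂P
      ≤ 80 * m ^ 3 * max 1 K / α * max (1 / √(n : ℝ)) (√(θ + θ ^ 2)) := by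
  have hm : 1 ≤ m := by
    rcases Nat.eq_zero_or_pos m with rfl | hm
    · simpa using hlam.1.2
    · exact hm
  obtain ⟨hα0, hle⟩ := integral_sq_dist_minimizer_le hn (X := fun k : Fin n => X (n + k))
    (fun k => h.law_X _) (h.aemeasurable_firstBatch n) (fun k => h.indepFun_firstBatch n k)
    (h.pairwise_indepFun_secondBatch n) hU hu (by positivity) (by positivity) hUu huB hlam hα
    hlamHat hmin
  exact hle.trans (error_bound_le hn hm hα0 hK hθ)

theorem theorem4p2 :
    -- the entropic barycenter functional
    (∃ J : ℝ, 0 < J ∧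
      ∀ (d m : ℕ) (Ω : Set (Euc d)) (ε σ : ℝ), 0 < ε →
      ∀ (μ : Measure (Euc d)) (ν : Fin m → Measure (Euc d)),
      IsP2 Ω μ → (∀ j, IsSubgaussian Ω σ (ν j)) →
      ∀ (lam : Fin m → ℝ) (α₂ : ℝ),
      SimpleZeroEigenvalue (entMatrix ε μ ν) lam →
      IsSmallestNonzeroEigenvalue (entMatrix ε μ ν) α₂ →
      ∀ (S : Type*) [MeasurableSpace S] (P : Measure S) [IsProbabilityMeasure P]
        (X : ℕ → S → Euc d) (Y : Fin m → ℕ → S → Euc d), IsSample P μ ν X Y →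
      ∀ (That : (n : ℕ) → Fin m → (Fin n → Euc d) → (Fin n → Euc d) → Euc d → Euc d)
        (θ : ℕ → ℝ),
      (∀ n j, Measurable fun p : (Fin n → Euc d) × (Fin n → Euc d) × Euc d =>
        That n j p.1 p.2.1 p.2.2) →
      (∀ n, 0 ≤ θ n) → Antitone θ →
      (∀ n, 1 ≤ n → ∀ j,
        expectedSqError P μ (entropicMap ε μ (ν j))
          (fun s => That n j (firstBatch n (X · s)) (firstBatch n (Y j · s)))
          ≤ ENNReal.ofReal (θ n)) →
      ∀ n, 1 ≤ n → ∀ lamHat : S → Fin m → ℝ, Measurable lamHat →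
      (∀ᵐ s ∂P, IsSimplexMinimizer
        (entMatrixHat (fun j => That n j (firstBatch n (X · s)) (firstBatch n (Y j · s)))
          (secondBatch n (X · s))) (lamHat s)) →
      ∫ s, ∑ i, (lamHat s i - lam i) ^ 2 ∂P ≤
        J * m ^ 3 * max 1 (d * σ ^ 2) / α₂ *
          max (1 / √(n : ℝ)) (√(θ n + θ n ^ 2))) ∧
    -- the Sinkhorn barycenter functional
    (∃ J : ℝ, 0 < J ∧
      ∀ (d m : ℕ) (Ω : Set (Euc d)) (ε σ : ℝ), 0 < ε →
      ∀ (μ : Measure (Euc d)) (ν : Fin m → Measure (Euc d)),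
      IsSubgaussian Ω σ μ → (∀ j, IsSubgaussian Ω σ (ν j)) →
      ∀ (lam : Fin m → ℝ) (α₂ : ℝ),
      SimpleZeroEigenvalue (sinkMatrix ε μ ν) lam →
      IsSmallestNonzeroEigenvalue (sinkMatrix ε μ ν) α₂ →
      ∀ (S : Type*) [MeasurableSpace S] (P : Measure S) [IsProbabilityMeasure P]
        (X : ℕ → S → Euc d) (Y : Fin m → ℕ → S → Euc d), IsSample P μ ν X Y →
      ∀ (That : (n : ℕ) → Fin m → (Fin n → Euc d) → (Fin n → Euc d) → Euc d → Euc d)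
        (That0 : (n : ℕ) → (Fin n → Euc d) → Euc d → Euc d) (θ : ℕ → ℝ),
      (∀ n j, Measurable fun p : (Fin n → Euc d) × (Fin n → Euc d) × Euc d =>
        That n j p.1 p.2.1 p.2.2) →
      (∀ n, Measurable fun p : (Fin n → Euc d) × Euc d => That0 n p.1 p.2) →
      (∀ n, 0 ≤ θ n) → Antitone θ →
      (∀ n, 1 ≤ n → ∀ j,
        expectedSqError P μ (entropicMap ε μ (ν j))
          (fun s => That n j (firstBatch n (X · s)) (firstBatch n (Y j · s)))
          ≤ ENNReal.ofReal (θ n)) →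
      (∀ n, 1 ≤ n →
        expectedSqError P μ (entropicMap ε μ μ) (fun s => That0 n (firstBatch n (X · s)))
          ≤ ENNReal.ofReal (θ n)) →
      ∀ n, 1 ≤ n → ∀ lamHat : S → Fin m → ℝ, Measurable lamHat →
      (∀ᵐ s ∂P, IsSimplexMinimizer
        (sinkMatrixHat (fun j => That n j (firstBatch n (X · s)) (firstBatch n (Y j · s)))
          (That0 n (firstBatch n (X · s))) (secondBatch n (X · s))) (lamHat s)) →
      ∫ s, ∑ i, (lamHat s i - lam i) ^ 2 ∂P ≤
        J * m ^ 3 * max 1 (d * σ ^ 2) / α₂ *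
          max (1 / √(n : ℝ)) (√(θ n + θ n ^ 2))) := by
  refine ⟨⟨80, by norm_num, ?_⟩, ⟨80, by norm_num, ?_⟩⟩
  · intro d m Ω ε σ hε μ ν hμ hν lam α₂ hlam hα S _ P _ X Y hXY That θ hThat hθ _ herr n hn lamHat
      hlamHat hmin
    have := hμ.isProb
    have := fun j => (hν j).isProb
    have hTm : ∀ j, Measurable (entropicMap ε μ (ν j)) := fun j => measurable_entropicMap ε μ (ν j)
    have hT4 : ∀ j, ∫⁻ x, ‖entropicMap ε μ (ν j) x‖ₑ ^ 4 ∂μ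
        ≤ ENNReal.ofReal (2 * (d * σ ^ 2) ^ 2) :=
      fun j => lintegral_entropicMap_pow_four_le hε (hν j)
    have hTL2 : ∀ j, MemLp (entropicMap ε μ (ν j)) 2 μ := fun j =>
      memLp_two_of_lintegral_sq_lt_top (hTm j).aestronglyMeasurable
        ((lintegral_sq_le_of_pow_four_le (B := 2 * (d * σ ^ 2)) (hTm j).enorm.aemeasurable
          (by positivity) ((hT4 j).trans (ENNReal.ofReal_le_ofReal (by
            nlinarith [sq_nonneg (d * σ ^ 2)])))).trans_lt ENNReal.ofReal_lt_top)
    -- the kernel vector exhibits the identity as a convex combination of the entropic maps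
    have hx : ∀ᵐ x ∂μ, x = ∑ i, lam i • entropicMap ε μ (ν i) x := by
      have hrel := sum_smul_ae_eq_zero_of_gram_mulVec_eq_zero
        (u := fun j x => entropicMap ε μ (ν j) x - x)
        (fun j => (hTL2 j).sub hμ.second_moment) hlam.2.1
      filter_upwards [hrel] with x hx
      simp only [smul_sub, Finset.sum_sub_distrib, ← Finset.sum_smul, hlam.1.2, one_smul] at hx
      exact (sub_eq_zero.1 hx).symm
    have hx4 := lintegral_norm_pow_four_le_of_convex_combination hTm hT4 hlam.1 hx
    refine hXY.integral_sq_dist_le hn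
      (U := fun j z => That n j z.1.1 (z.1.2 j) z.2 - z.2)
      (u := fun j x => entropicMap ε μ (ν j) x - x) (fun j => ?_)
      (fun j => (hTm j).sub measurable_id) (K := d * σ ^ 2) (by positivity) (hθ n) (fun j => ?_)
      (fun j => lintegral_sub_pow_four_le (hTm j) (hT4 j) hx4) hlam hα hlamHat hmin
    · have hsel : Measurable fun z : ((Fin n → Euc d) × (Fin m → Fin n → Euc d)) × Euc d =>
          (z.1.1, z.1.2 j, z.2) := by fun_prop
      exact ((hThat n j).comp hsel).sub measurable_snd
    · have h1 := herr n hn j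
      rw [expectedSqError_eq] at h1
      simp only [sub_sub_sub_cancel_right]
      exact h1.trans (ENNReal.ofReal_le_ofReal (by linarith [hθ n]))
  · intro d m Ω ε σ hε μ ν hμ hν lam α₂ hlam hα S _ P _ X Y hXY That That0 θ hThat hThat0 hθ _ herr
      herr0 n hn lamHat hlamHat hmin
    have := hμ.isProb
    have := fun j => (hν j).isProb
    have hTm : ∀ j, Measurable (entropicMap ε μ (ν j)) := fun j => measurable_entropicMap ε μ (ν j)
    have hRm : Measurable (entropicMap ε μ μ) := measurable_entropicMap ε μ μ
    have hFm : ∀ j, Measurable fun z : ((Fin n → Euc d) × (Fin m → Fin n → Euc d)) × Euc d =>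
        That n j z.1.1 (z.1.2 j) z.2 := by
      intro j
      have hsel : Measurable fun z : ((Fin n → Euc d) × (Fin m → Fin n → Euc d)) × Euc d =>
          (z.1.1, z.1.2 j, z.2) := by fun_prop
      exact (hThat n j).comp hsel
    have hGm : Measurable fun z : ((Fin n → Euc d) × (Fin m → Fin n → Euc d)) × Euc d =>
        That0 n z.1.1 z.2 := by
      have hsel : Measurable fun z : ((Fin n → Euc d) × (Fin m → Fin n → Euc d)) × Euc d =>
          (z.1.1, z.2) := by fun_prop
      exact (hThat0 n).comp hsel
    refine hXY.integral_sq_dist_le hn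
      (U := fun j z => That n j z.1.1 (z.1.2 j) z.2 - That0 n z.1.1 z.2)
      (u := fun j x => entropicMap ε μ (ν j) x - entropicMap ε μ μ x) (fun j => (hFm j).sub hGm)
      (fun j => (hTm j).sub hRm) (K := d * σ ^ 2) (by positivity) (hθ n) (fun j => ?_)
      (fun j => lintegral_sub_pow_four_le (hTm j)
        (lintegral_entropicMap_pow_four_le hε (hν j)) (lintegral_entropicMap_pow_four_le hε hμ))
      hlam hα hlamHat hmin
    have h1 := herr n hn j
    have h2 := herr0 n hn
    rw [expectedSqError_eq] at h1 h2
    exact lintegral_sub_sub_sq_le (G := fun z => That0 n z.1.1 z.2)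
      (hXY.aemeasurable_firstBatch n) (hFm j) (hTm j) (hθ n) h1 h2
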